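/- Let $\mathcal X\subset\mathbb R^d$ be a Borel set, $\mu$ a probability measure on $\mathcal X$, and $f,f_1,\dots,f_M:\mathcal X\to\mathbb R$ measurable functions bounded in absolute value by a constant $L<\infty$. One observes $(X_1,Y_1),\dots,(X_n,Y_n)$ with $Y_i=f(X_i)+W_i$, where the pairs $(X_i,W_i)$ are independent, $X_i$ has distribution $\mu$, and $W_i$ is independent of $X_i$ with distribution $N(0,\sigma^2)$, $\sigma^2>0$. Write $\|g\|^2=\int g^2\,d\mu$, $\mathsf f_\lambda=\sum_{j=1}^M\lambda_jf_j$, $M(\lambda)=\#\{j:\lambda_j\neq0\}$ for $\lambda\in\mathbb R^M$, and $\Lambda^M=\{\lambda\in\mathbb R^M:\lambda_j\ge0,\ \sum_{j=1}^M\lambda_j\le1\}$. Fix $T\ge1$ and let $\tilde f=\mathsf f_{\hat\lambda}$, where $\hat\lambda$ is a (measurable) minimizer, over $\{\lambda\in\mathbb R^M:\sum_{j=1}^M|\lambda_j|\le T\}$, of $$\frac1n\sum_{i=1}^n\bigl(Y_i-\mathsf f_\lambda(X_i)\bigr)^2+K_1\frac{M(\lambda)}n\log\Bigl(1+\frac{M\vee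 n}{M(\lambda)\vee1}\Bigr).$$ Then there are thresholds $K^*(\varepsilon)>0$, $\varepsilon>0$, depending only on $\varepsilon$, $L$, $\sigma^2$ and $T$, such that the following holds. For every $\kappa\ge1$ there is a constant $C'>0$ depending only on $L$, $\sigma^2$, $T$ and $\kappa$ such that for all $\varepsilon>0$, all $K_1$ with $K^*(\varepsilon)\le K_1\le\kappa K^*(\varepsilon)$, all integers $n\ge1$, $M\ge2$, and all $d,\mathcal X,\mu,f,f_1,\dots,f_M$ as above, $$\mathbb E\|\tilde f-f\|^2\le(1+\varepsilon)\inf_{\lambda\in\Lambda^M}\|\mathsf f_\lambda-f\|^2+C'\bigl(1+\varepsilon+\varepsilon^{-1}\bigr)\tilde\psi_n^C(M),$$ where $$\tilde\psi_n^C(M)=\begin{cases}(M\log n)/n&\text{if }M\le\sqrt n,\\[2pt]\sqrt{\log\bigl(1+(M\vee n)/\sqrt n\bigr)/n}&\text{if }M>\sqrt n.\end{cases}$$ -/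

import Mathlib

open MeasureTheory ProbabilityTheory
open scoped NNReal

namespace Aggregation

noncomputable section

/-- The linear combination `f_λ(x) = ∑ j, λ_j f_j(x)` of the functions `f_1, …, f_M`. -/
def comb {S : Type*} {M : ℕ} (fs : Fin M → S → ℝ) (lam : Fin M → ℝ) (x : S) : ℝ :=
  ∑ j, lam j * fs j x

/-- `M(λ)`, the number of non-zero coordinates of `λ`. -/
def numNonzero {M : ℕ} (lam : Fin M → ℝ) : ℕ :=
  (Finset.univ.filter fun j => lam j ≠ 0).card

/-- The simplex `Λ^M`: non-negative coordinates with sum at most one. -/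
def simplex (M : ℕ) : Set (Fin M → ℝ) :=
  {lam | (∀ j, 0 ≤ lam j) ∧ ∑ j, lam j ≤ 1}

/-- The `ℓ₁`-ball `Λ_{M,T}` of radius `T`. -/
def l1Ball (M : ℕ) (T : ℝ) : Set (Fin M → ℝ) :=
  {lam | ∑ j, |lam j| ≤ T}

/-- The residual sum of squares `Ŝ(λ) = n⁻¹ ∑ i, (y_i - f_λ(x_i))²` of the data `(x_i, y_i)`. -/
def residual {S : Type*} {n M : ℕ} (fs : Fin M → S → ℝ) (x : Fin n → S) (y : Fin n → ℝ)
    (lam : Fin M → ℝ) : ℝ :=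
  (1 / (n : ℝ)) * ∑ i, (y i - comb fs lam (x i)) ^ 2

/-- The hard threshold penalty
`pen(λ) = K₁ (M(λ) / n) log (1 + (M ∨ n) / (M(λ) ∨ 1))`. -/
def hardPenalty (n : ℕ) {M : ℕ} (K₁ : ℝ) (lam : Fin M → ℝ) : ℝ :=
  K₁ * ((numNonzero lam : ℝ) / n) *
    Real.log (1 + max (M : ℝ) (n : ℝ) / max (numNonzero lam : ℝ) 1)

/-- `lam` is a minimizer of `Ŝ(λ) + pen(λ)` over the `ℓ₁`-ball of radius `T`. -/
def IsPenalizedLSE {S : Type*} {n M : ℕ} (T K₁ : ℝ) (fs : Fin M → S → ℝ)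
    (x : Fin n → S) (y : Fin n → ℝ) (lam : Fin M → ℝ) : Prop :=
  lam ∈ l1Ball M T ∧
    IsMinOn (fun l => residual fs x y l + hardPenalty n K₁ l) (l1Ball M T) lam

/-- The norm `‖g‖ = (∫ g² dμ)^{1/2}`. -/
def l2Norm {S : Type*} [MeasurableSpace S] (μ : Measure S) (g : S → ℝ) : ℝ :=
  Real.sqrt (∫ x, g x ^ 2 ∂μ)

/-- The rate: `(M log n) / n` if `M ≤ √n`, and
`√(log (1 + (M ∨ n) / √n) / n)` if `M > √n`. -/
def convexRate (n M : ℕ) : ℝ :=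
  if (M : ℝ) ≤ Real.sqrt n then (M : ℝ) * Real.log n / n
  else Real.sqrt (Real.log (1 + max (M : ℝ) (n : ℝ) / Real.sqrt n) / n)

end

end Aggregation

open Aggregation

/-! Removing the noise energy from the empirical risk leaves `centeredResidual`, an unbiased
estimate of `risk`. Suppose one integrable variable R dominates `risk - c * centeredResidual` on the
whole ℓ₁-ball. Minimality of the estimator and nonnegativity of its penalty then give E risk(λ̂) ≤ c
(risk(λ) + pen(λ)) + E R for every fixed λ in the ball (`integral_risk_estimator_le`). It remains to
build R and to choose λ.

If M ≤ √n, take c = 1 + ε. Since g² bounds the variance of its own fluctuations up to a constant,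
the slack ε pays for them: at each fixed λ the deviation, scaled by n t with t of order ε/(1+ε)²,
has exponential moment at most one. A net of (4Tn²)^M points extends this to the ball at cost M log
n / n (`exists_dominating_fast`). The penalty at λ has the same order.

If M > √n, take c = 1. The deviation is a quadratic plus a linear form in the coefficients, so the
ℓ₁-constraint reduces it to the maximum of about M² sub-Gaussian averages
(`exists_dominating_slow`). A dense λ would be penalized too heavily; Maurey's lemma
(`exists_sparse_risk_le`) replaces it by a sparse one, with sparsity balancing approximation error
and penalty.

The penalty matters only through its sign at λ̂ and its size at λ. The threshold is therefore chosen
solely to keep (1+ε)K₁ of order 1+ε+ε⁻¹. -/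

namespace Aggregation

/-! ### Exponential moments and a maximal inequality in expectation. -/

/-- A finite family of random variables with exponential moments at most one is dominated by a
single random variable of mean at most the logarithm of the size of the family. -/
theorem exists_integrable_dominating {Ω : Type*} [MeasurableSpace Ω] {P : Measure Ω}
    [IsProbabilityMeasure P] {ι : Type*} (N : Finset ι) (hN : N.Nonempty) (Z : ι → Ω → ℝ)
    (hint : ∀ i ∈ N, Integrable (fun ω => Real.exp (Z i ω)) P)
    (hle : ∀ i ∈ N, ∫ ω, Real.exp (Z i ω) ∂P ≤ 1) :
    ∃ R : Ω → ℝ, Integrable R P ∧ ∫ ω, R ω ∂P ≤ Real.log N.card ∧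
      ∀ ω, ∀ i ∈ N, Z i ω ≤ R ω := by
  have hc : (0 : ℝ) < N.card := by exact_mod_cast hN.card_pos
  have hsum : Integrable (fun ω => ∑ i ∈ N, Real.exp (Z i ω)) P := integrable_finsetSum _ hint
  -- The tangent line of exp at 0, applied to Z - log |N|, gives Z ≤ log |N| - 1 + exp(Z)/|N|;
  -- summing the exponentials makes the bound uniform in the index.
  refine ⟨fun ω => Real.log N.card - 1 + (∑ i ∈ N, Real.exp (Z i ω)) / N.card, ?_, ?_, ?_⟩
  · exact (integrable_const _).add (hsum.div_const _)
  · rw [integral_add (integrable_const _) (hsum.div_const _), integral_div,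
      integral_finsetSum _ hint]
    have h1 : ∑ i ∈ N, ∫ ω, Real.exp (Z i ω) ∂P ≤ N.card := by
      simpa using Finset.sum_le_sum hle
    have h2 : (∑ i ∈ N, ∫ ω, Real.exp (Z i ω) ∂P) / N.card ≤ 1 := (div_le_one hc).2 h1
    simp only [integral_const, probReal_univ, smul_eq_mul, one_mul]
    linarith
  · intro ω i hi
    have h1 : Real.exp (Z i ω) ≤ ∑ i ∈ N, Real.exp (Z i ω) :=
      Finset.single_le_sum (f := fun i => Real.exp (Z i ω)) (fun _ _ => (Real.exp_pos _).le) hi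
    have h2 : Real.exp (Z i ω) / N.card ≤ (∑ i ∈ N, Real.exp (Z i ω)) / N.card := by gcongr
    have h3 := Real.add_one_le_exp (Z i ω - Real.log N.card)
    rw [Real.exp_sub, Real.exp_log hc] at h3
    linarith

/-- The joint law of independent random variables is the product of their laws. -/
theorem hasLaw_prodMk {Ω S R : Type*} [MeasurableSpace Ω] [MeasurableSpace S] [MeasurableSpace R]
    {P : Measure Ω} [IsProbabilityMeasure P] {μ : Measure S} {ρ : Measure R}
    {X : Ω → S} {W : Ω → R}
    (hX : HasLaw X μ P) (hW : HasLaw W ρ P) (h : IndepFun X W P) :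
    HasLaw (fun ω => (X ω, W ω)) (μ.prod ρ) P :=
  (indepFun_iff_hasLaw_prodMk_prod hX hW).1 h

/-- The exponential moment of an affine function of a Gaussian variable whose coefficients are
bounded functions of an independent variable. -/
theorem integrable_exp_affine_gaussian {S : Type*} [MeasurableSpace S] {μ : Measure S}
    [IsProbabilityMeasure μ] (v : ℝ≥0) {a b : S → ℝ} (ha : Measurable a) (hb : Measurable b)
    {A B : ℝ} (hA : ∀ x, |a x| ≤ A) (hB : ∀ x, |b x| ≤ B) :
    Integrable (fun z : S × ℝ => Real.exp (a z.1 + b z.1 * z.2)) (μ.prod (gaussianReal 0 v)) ∧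
    ∫ z, Real.exp (a z.1 + b z.1 * z.2) ∂(μ.prod (gaussianReal 0 v)) =
      ∫ x, Real.exp (a x + v * b x ^ 2 / 2) ∂μ := by
  have hsec : ∀ x, ∫ w, Real.exp (a x + b x * w) ∂(gaussianReal 0 v) =
      Real.exp (a x + v * b x ^ 2 / 2) := by
    intro x
    have h := congrFun (mgf_fun_id_gaussianReal (μ := 0) (v := v)) (b x)
    simp only [mgf, zero_mul, zero_add] at h
    simp_rw [Real.exp_add, integral_const_mul, h]
  have hint : Integrable (fun z : S × ℝ => Real.exp (a z.1 + b z.1 * z.2))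
      (μ.prod (gaussianReal 0 v)) := by
    rw [integrable_prod_iff (by fun_prop)]
    refine ⟨Filter.Eventually.of_forall fun x => ?_, ?_⟩
    · simp_rw [Real.exp_add]
      exact (integrable_exp_mul_gaussianReal (b x)).const_mul _
    · simp_rw [Real.norm_eq_abs, Real.abs_exp, hsec]
      refine Integrable.of_bound (by fun_prop) (Real.exp (A + v * B ^ 2 / 2))
        (Filter.Eventually.of_forall fun x => ?_)
      rw [Real.norm_eq_abs, Real.abs_exp]
      have h1 := (abs_le.1 (hA x)).2
      have h2 : b x ^ 2 ≤ B ^ 2 := sq_le_sq' (abs_le.1 (hB x)).1 (abs_le.1 (hB x)).2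
      gcongr
  exact ⟨hint, by rw [integral_prod _ hint]; simp_rw [hsec]⟩

/-- If `E exp φ(Z₁) ≤ 1` then `E exp (∑ φ(Z_i)) ≤ 1` for an i.i.d. sample. -/
theorem integrable_exp_sum_iid {Ω R : Type*} [MeasurableSpace Ω] [MeasurableSpace R]
    {P : Measure Ω} [IsProbabilityMeasure P] {ν : Measure R} [IsProbabilityMeasure ν] {n : ℕ} {Z : Fin n → Ω → R}
    (hZ : ∀ i, HasLaw (Z i) ν P) (hindep : iIndepFun Z P) {φ : R → ℝ} (hφ : Measurable φ)
    (hint : Integrable (fun z => Real.exp (φ z)) ν) (hle : ∫ z, Real.exp (φ z) ∂ν ≤ 1) :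
    Integrable (fun ω => Real.exp (∑ i, φ (Z i ω))) P ∧
    ∫ ω, Real.exp (∑ i, φ (Z i ω)) ∂P ≤ 1 := by
  have hmeas : ∀ i, AEMeasurable (fun ω => φ (Z i ω)) P :=
    fun i => hφ.comp_aemeasurable (hZ i).aemeasurable
  have hi : iIndepFun (fun i ω => φ (Z i ω)) P := hindep.comp (fun _ => φ) (fun _ => hφ)
  have hone : ∀ i, mgf (fun ω => φ (Z i ω)) P 1 = ∫ z, Real.exp (φ z) ∂ν := by
    intro i
    simp only [mgf, one_mul]
    exact (hZ i).integral_comp (f := fun z => Real.exp (φ z)) (by fun_prop)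
  have hpos : 0 < ∫ z, Real.exp (φ z) ∂ν := integral_exp_pos hint
  have hsum := hi.mgf_sum₀ (t := 1) hmeas Finset.univ
  simp only [hone, Finset.prod_const] at hsum
  have heq : mgf (∑ i, fun ω => φ (Z i ω)) P 1 = ∫ ω, Real.exp (∑ i, φ (Z i ω)) ∂P := by
    simp [mgf]
  constructor
  -- A non-integrable exponential would have `mgf` equal to the default value 0, so positivity of
  -- the product of moments yields integrability.
  · have h := mgf_pos_iff (X := ∑ i, fun ω => φ (Z i ω)) (μ := P) (t := 1)
    rw [hsum] at h
    simpa using h.1 (pow_pos hpos _)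
  · rw [← heq, hsum]
    exact pow_le_one₀ hpos.le hle

/-- (1 - u + u²/2)(1 + u + u²/2) = 1 + u⁴/4 ≥ 1, and the second factor is at most exp u. -/
theorem exp_neg_le_quadratic {u : ℝ} (hu : 0 ≤ u) : Real.exp (-u) ≤ 1 - u + u ^ 2 / 2 := by
  have h := Real.quadratic_le_exp_of_nonneg hu
  have h1 : Real.exp (-u) * Real.exp u = 1 := by rw [← Real.exp_add]; simp
  have h2 : 0 < 1 - u + u ^ 2 / 2 := by nlinarith [sq_nonneg (u - 1)]
  have h3 : 1 ≤ (1 - u + u ^ 2 / 2) * Real.exp u := by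
    calc (1 : ℝ) ≤ (1 - u + u ^ 2 / 2) * (1 + u + u ^ 2 / 2) := by nlinarith [sq_nonneg (u ^ 2)]
      _ ≤ _ := by gcongr
  exact le_of_mul_le_mul_right (h1.trans_le h3) (Real.exp_pos _)

/-! ### Risk and centered residual as functions of the coefficients. -/

/-- The squared `L²(μ)` distance between `f_λ` and `f`. -/
noncomputable def risk {S : Type*} [MeasurableSpace S] (μ : Measure S) {M : ℕ} (f : S → ℝ)
    (fs : Fin M → S → ℝ) (lam : Fin M → ℝ) : ℝ :=
  ∫ x, (comb fs lam x - f x) ^ 2 ∂μ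

/-- The residual sum of squares of the data `(x_i, f(x_i) + w_i)`, up to a term not depending
on `λ`. -/
noncomputable def centeredResidual {S : Type*} {n M : ℕ} (f : S → ℝ) (fs : Fin M → S → ℝ)
    (z : Fin n → S × ℝ) (lam : Fin M → ℝ) : ℝ :=
  (1 / (n : ℝ)) * ∑ i, ((comb fs lam (z i).1 - f (z i).1) ^ 2 -
    2 * (z i).2 * (comb fs lam (z i).1 - f (z i).1))

section Deterministic

variable {S : Type*} {n M : ℕ} {f : S → ℝ} {fs : Fin M → S → ℝ} {L T : ℝ}

theorem residual_eq (z : Fin n → S × ℝ) (lam : Fin M → ℝ) :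
    residual fs (fun i => (z i).1) (fun i => f (z i).1 + (z i).2) lam =
      (1 / (n : ℝ)) * ∑ i, (z i).2 ^ 2 + centeredResidual f fs z lam := by
  unfold residual centeredResidual
  rw [← mul_add, ← Finset.sum_add_distrib]
  congr 1
  exact Finset.sum_congr rfl fun i _ => by ring

theorem hardPenalty_nonneg {K₁ : ℝ} (hK : 0 ≤ K₁) (lam : Fin M → ℝ) :
    0 ≤ hardPenalty n K₁ lam := by
  unfold hardPenalty
  refine mul_nonneg (by positivity) (Real.log_nonneg ?_)
  have : 0 ≤ max (M : ℝ) n / max (numNonzero lam : ℝ) 1 := by positivity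
  linarith

/-- The defining property of the penalized estimator in terms of the centered residuals. -/
theorem IsPenalizedLSE.centeredResidual_le {K₁ : ℝ} (hK : 0 ≤ K₁) {z : Fin n → S × ℝ}
    {lamHat lam : Fin M → ℝ}
    (h : IsPenalizedLSE T K₁ fs (fun i => (z i).1) (fun i => f (z i).1 + (z i).2) lamHat)
    (hlam : lam ∈ l1Ball M T) :
    centeredResidual f fs z lamHat ≤ centeredResidual f fs z lam + hardPenalty n K₁ lam := by
  have h1 := h.2 hlam
  simp only [Set.mem_ofPred_eq, residual_eq] at h1
  have h2 := hardPenalty_nonneg (n := n) hK lamHat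
  linarith

theorem mem_l1Ball {lam : Fin M → ℝ} : lam ∈ l1Ball M T ↔ ∑ j, |lam j| ≤ T := Iff.rfl

theorem simplex_subset_l1Ball (hT : 1 ≤ T) : simplex M ⊆ l1Ball M T := by
  rintro lam ⟨h0, h1⟩
  have : ∑ j, |lam j| = ∑ j, lam j := Finset.sum_congr rfl fun j _ => abs_of_nonneg (h0 j)
  exact this.trans_le (h1.trans hT)

theorem abs_comb_le (hfs : ∀ j x, |fs j x| ≤ L) (lam : Fin M → ℝ) (x : S) :
    |comb fs lam x| ≤ L * ∑ j, |lam j| := by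
  unfold comb
  rw [Finset.mul_sum]
  refine (Finset.abs_sum_le_sum_abs _ _).trans (Finset.sum_le_sum fun j _ => ?_)
  rw [abs_mul, mul_comm]
  exact mul_le_mul_of_nonneg_right (hfs j x) (abs_nonneg _)

theorem abs_comb_sub_le (hL : 0 ≤ L) (hf : ∀ x, |f x| ≤ L) (hfs : ∀ j x, |fs j x| ≤ L)
    {lam : Fin M → ℝ} (hlam : lam ∈ l1Ball M T) (x : S) :
    |comb fs lam x - f x| ≤ (T + 1) * L := by
  have h1 := abs_comb_le hfs lam x
  have h2 : L * ∑ j, |lam j| ≤ L * T := mul_le_mul_of_nonneg_left hlam hL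
  calc |comb fs lam x - f x| ≤ |comb fs lam x| + |f x| := abs_sub _ _
    _ ≤ (T + 1) * L := by linarith [hf x]

theorem comb_sub (lam theta : Fin M → ℝ) (x : S) :
    comb fs lam x - comb fs theta x = comb fs (lam - theta) x := by
  simp [comb, ← Finset.sum_sub_distrib, sub_mul]

end Deterministic

section Measure

variable {S : Type*} [MeasurableSpace S] {μ : Measure S} {n M : ℕ} {f : S → ℝ}
  {fs : Fin M → S → ℝ} {L T : ℝ}

@[fun_prop]
theorem measurable_comb (hfs : ∀ j, Measurable (fs j)) (lam : Fin M → ℝ) :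
    Measurable (comb fs lam) := by
  unfold comb
  fun_prop

theorem l2Norm_sq (lam : Fin M → ℝ) :
    l2Norm μ (fun x => comb fs lam x - f x) ^ 2 = risk μ f fs lam :=
  Real.sq_sqrt (integral_nonneg fun _ => sq_nonneg _)

theorem risk_nonneg (lam : Fin M → ℝ) : 0 ≤ risk μ f fs lam :=
  integral_nonneg fun _ => sq_nonneg _

variable [IsProbabilityMeasure μ]

theorem integrable_comb_sub_sq (hL : 0 ≤ L) (hfm : Measurable f) (hfsm : ∀ j, Measurable (fs j))
    (hf : ∀ x, |f x| ≤ L) (hfs : ∀ j x, |fs j x| ≤ L) (lam : Fin M → ℝ) :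
    Integrable (fun x => (comb fs lam x - f x) ^ 2) μ := by
  refine Integrable.of_bound (by fun_prop) ((((∑ j, |lam j|) + 1) * L) ^ 2)
    (Filter.Eventually.of_forall fun x => ?_)
  have h := abs_comb_sub_le hL hf hfs (T := ∑ j, |lam j|) (lam := lam) (mem_l1Ball.2 le_rfl) x
  rw [Real.norm_eq_abs, abs_of_nonneg (sq_nonneg _), ← sq_abs]
  gcongr

theorem risk_le (hL : 0 ≤ L) (hfm : Measurable f) (hfsm : ∀ j, Measurable (fs j))
    (hf : ∀ x, |f x| ≤ L) (hfs : ∀ j x, |fs j x| ≤ L) {lam : Fin M → ℝ}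
    (hlam : lam ∈ l1Ball M T) : risk μ f fs lam ≤ ((T + 1) * L) ^ 2 := by
  have h := integral_mono (μ := μ) (integrable_comb_sub_sq hL hfm hfsm hf hfs lam)
    (integrable_const (((T + 1) * L) ^ 2)) (fun x => by
      have h := abs_comb_sub_le hL hf hfs hlam x
      rw [← sq_abs]
      exact pow_le_pow_left₀ (abs_nonneg _) h 2)
  simpa [risk] using h

/-- The risk is a continuous function of the coefficients. -/
theorem continuous_risk (hL : 0 ≤ L) (hfm : Measurable f) (hfsm : ∀ j, Measurable (fs j))
    (hf : ∀ x, |f x| ≤ L) (hfs : ∀ j x, |fs j x| ≤ L) :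
    Continuous (risk μ f fs) := by
  have hb : ∀ g h : S → ℝ, Measurable g → Measurable h → (∀ x, |g x| ≤ L) → (∀ x, |h x| ≤ L) →
      Integrable (fun x => g x * h x) μ := by
    intro g h hgm hhm hg hh
    refine Integrable.of_bound (by fun_prop) (L * L) (Filter.Eventually.of_forall fun x => ?_)
    rw [Real.norm_eq_abs, abs_mul]
    exact mul_le_mul (hg x) (hh x) (abs_nonneg _) hL
  -- The risk is a quadratic polynomial in λ. Its continuity is what makes the risk of the random
  -- estimator measurable.
  have heq : risk μ f fs = fun lam => (∑ j, ∑ k, lam j * lam k * ∫ x, fs j x * fs k x ∂μ) -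
      2 * (∑ j, lam j * ∫ x, fs j x * f x ∂μ) + ∫ x, f x * f x ∂μ := by
    funext lam
    have h1 : ∀ x, (comb fs lam x - f x) ^ 2 = (∑ j, ∑ k, lam j * lam k * (fs j x * fs k x)) -
        2 * (∑ j, lam j * (fs j x * f x)) + f x * f x := by
      intro x
      have h2 : ∑ j, ∑ k, lam j * lam k * (fs j x * fs k x) = comb fs lam x * comb fs lam x := by
        simp only [comb, Finset.sum_mul_sum]
        exact Finset.sum_congr rfl fun j _ => Finset.sum_congr rfl fun k _ => by ring
      have h3 : ∑ j, lam j * (fs j x * f x) = comb fs lam x * f x := by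
        simp only [comb, Finset.sum_mul]
        exact Finset.sum_congr rfl fun j _ => by ring
      rw [h2, h3]; ring
    have i1 : ∀ j k, Integrable (fun x => lam j * lam k * (fs j x * fs k x)) μ :=
      fun j k => (hb _ _ (hfsm j) (hfsm k) (hfs j) (hfs k)).const_mul _
    have i2 : ∀ j, Integrable (fun x => lam j * (fs j x * f x)) μ :=
      fun j => (hb _ _ (hfsm j) hfm (hfs j) hf).const_mul _
    have i3 := hb f f hfm hfm hf hf
    have j1 : Integrable (fun x => ∑ j, ∑ k, lam j * lam k * (fs j x * fs k x)) μ :=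
      integrable_finsetSum _ fun j _ => integrable_finsetSum _ fun k _ => i1 j k
    have j2 : Integrable (fun x => 2 * ∑ j, lam j * (fs j x * f x)) μ :=
      (integrable_finsetSum _ fun j _ => i2 j).const_mul _
    simp only [risk, h1]
    have j12 : Integrable (fun x => (∑ j, ∑ k, lam j * lam k * (fs j x * fs k x)) -
        2 * ∑ j, lam j * (fs j x * f x)) μ := j1.sub j2
    rw [integral_add j12 i3, integral_sub j1 j2, integral_const_mul,
      integral_finsetSum _ fun j _ => i2 j,
      integral_finsetSum _ fun j _ => integrable_finsetSum _ fun k _ => i1 j k]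
    simp_rw [integral_finsetSum _ fun k _ => i1 _ k, integral_const_mul]
  rw [heq]
  fun_prop

end Measure

/-! ### From a uniform deviation bound to an oracle inequality. -/

section Sample

variable {S : Type*} [MeasurableSpace S] {μ : Measure S} [IsProbabilityMeasure μ] {n M : ℕ}
  {f : S → ℝ} {fs : Fin M → S → ℝ} {L T : ℝ} {v : ℝ≥0} {Ω : Type*} [MeasurableSpace Ω]
  {P : Measure Ω} [IsProbabilityMeasure P] {Z : Fin n → Ω → S × ℝ}

-- Unbiasedness: the cross term vanishes because the noise is centered and independent of the
-- design.
omit [IsProbabilityMeasure P] in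
theorem integrable_centeredResidual (hL : 0 ≤ L) (hfm : Measurable f)
    (hfsm : ∀ j, Measurable (fs j)) (hf : ∀ x, |f x| ≤ L) (hfs : ∀ j x, |fs j x| ≤ L)
    (hn : 1 ≤ n) (hZ : ∀ i, HasLaw (Z i) (μ.prod (gaussianReal 0 v)) P) (lam : Fin M → ℝ) :
    Integrable (fun ω => centeredResidual f fs (fun i => Z i ω) lam) P ∧
    ∫ ω, centeredResidual f fs (fun i => Z i ω) lam ∂P = risk μ f fs lam := by
  set ν := μ.prod (gaussianReal 0 v)
  have hsq := integrable_comb_sub_sq (μ := μ) hL hfm hfsm hf hfs lam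
  have hg : Integrable (fun x => comb fs lam x - f x) μ :=
    Integrable.of_bound (by fun_prop) (((∑ j, |lam j|) + 1) * L) (Filter.Eventually.of_forall
      fun x => abs_comb_sub_le hL hf hfs (T := ∑ j, |lam j|) (lam := lam) (mem_l1Ball.2 le_rfl) x)
  have hw : Integrable (fun w : ℝ => w) (gaussianReal 0 v) :=
    (memLp_id_gaussianReal' 1 (by simp)).integrable le_rfl
  have h1 : Integrable (fun z : S × ℝ => (comb fs lam z.1 - f z.1) ^ 2) ν := hsq.comp_fst _
  have h2 : Integrable (fun z : S × ℝ => (comb fs lam z.1 - f z.1) * z.2) ν := hg.mul_prod hw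
  have h3 : Integrable (fun z : S × ℝ => (comb fs lam z.1 - f z.1) ^ 2 -
      2 * z.2 * (comb fs lam z.1 - f z.1)) ν := by
    refine (h1.sub (h2.const_mul 2)).congr (Filter.Eventually.of_forall fun z => ?_)
    simp only [Pi.sub_apply]; ring
  have h4 : ∫ z, ((comb fs lam z.1 - f z.1) ^ 2 - 2 * z.2 * (comb fs lam z.1 - f z.1)) ∂ν =
      risk μ f fs lam := by
    have : ∀ z : S × ℝ, (comb fs lam z.1 - f z.1) ^ 2 - 2 * z.2 * (comb fs lam z.1 - f z.1) =
      (comb fs lam z.1 - f z.1) ^ 2 - 2 * ((comb fs lam z.1 - f z.1) * z.2) := fun z => by ring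
    simp_rw [this]
    rw [integral_sub h1 (h2.const_mul 2), integral_const_mul,
      integral_prod_mul (fun x => comb fs lam x - f x) (fun w => w),
      integral_fun_fst (fun x => (comb fs lam x - f x) ^ 2), integral_id_gaussianReal]
    simp [risk]
  have h5 : ∀ i, Integrable (fun ω => (comb fs lam (Z i ω).1 - f (Z i ω).1) ^ 2 -
      2 * (Z i ω).2 * (comb fs lam (Z i ω).1 - f (Z i ω).1)) P := by
    intro i
    have := h3
    rw [← (hZ i).map_eq] at this
    exact this.comp_aemeasurable (hZ i).aemeasurable
  have h6 : ∀ i, ∫ ω, ((comb fs lam (Z i ω).1 - f (Z i ω).1) ^ 2 -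
      2 * (Z i ω).2 * (comb fs lam (Z i ω).1 - f (Z i ω).1)) ∂P = risk μ f fs lam := by
    intro i
    rw [← h4]
    exact (hZ i).integral_comp h3.aestronglyMeasurable
  refine ⟨(integrable_finsetSum _ fun i _ => h5 i).const_mul _, ?_⟩
  unfold centeredResidual
  rw [integral_const_mul, integral_finsetSum _ fun i _ => h5 i]
  simp only [h6, Finset.sum_const, Finset.card_univ, Fintype.card_fin, nsmul_eq_mul]
  have : (n : ℝ) ≠ 0 := by positivity
  field_simp

theorem integrable_risk_estimator (hL : 0 ≤ L) (hfm : Measurable f)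
    (hfsm : ∀ j, Measurable (fs j)) (hf : ∀ x, |f x| ≤ L) (hfs : ∀ j x, |fs j x| ≤ L)
    {lamHat : Ω → Fin M → ℝ} (hm : AEMeasurable lamHat P)
    (hball : ∀ᵐ ω ∂P, lamHat ω ∈ l1Ball M T) :
    Integrable (fun ω => risk μ f fs (lamHat ω)) P := by
  refine Integrable.of_bound ((continuous_risk hL hfm hfsm hf hfs).measurable.comp_aemeasurable
    hm).aestronglyMeasurable (((T + 1) * L) ^ 2) ?_
  filter_upwards [hball] with ω hω
  rw [Real.norm_eq_abs, abs_of_nonneg (risk_nonneg _)]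
  exact risk_le hL hfm hfsm hf hfs hω

/-- A uniform control of the risk by the centered residuals yields an oracle inequality. -/
theorem integral_risk_estimator_le (hL : 0 ≤ L) (hfm : Measurable f)
    (hfsm : ∀ j, Measurable (fs j)) (hf : ∀ x, |f x| ≤ L) (hfs : ∀ j x, |fs j x| ≤ L)
    (hn : 1 ≤ n) (hZ : ∀ i, HasLaw (Z i) (μ.prod (gaussianReal 0 v)) P)
    {K₁ c : ℝ} (hK : 0 ≤ K₁) (hc : 0 ≤ c) {R : Ω → ℝ} (hR : Integrable R P)
    (hdom : ∀ ω, ∀ lam ∈ l1Ball M T,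
      risk μ f fs lam - c * centeredResidual f fs (fun i => Z i ω) lam ≤ R ω)
    {lamHat : Ω → Fin M → ℝ} (hm : AEMeasurable lamHat P)
    (hlse : ∀ᵐ ω ∂P, IsPenalizedLSE T K₁ fs (fun i => (Z i ω).1)
      (fun i => f (Z i ω).1 + (Z i ω).2) (lamHat ω))
    {lam : Fin M → ℝ} (hlam : lam ∈ l1Ball M T) :
    ∫ ω, risk μ f fs (lamHat ω) ∂P ≤
      c * (risk μ f fs lam + hardPenalty n K₁ lam) + ∫ ω, R ω ∂P := by
  have hint := integrable_risk_estimator (μ := μ) hL hfm hfsm hf hfs hm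
    (hlse.mono fun ω h => h.1)
  obtain ⟨h1, h2⟩ := integrable_centeredResidual hL hfm hfsm hf hfs hn hZ lam
  have h3 : Integrable (fun ω => c * (centeredResidual f fs (fun i => Z i ω) lam +
    hardPenalty n K₁ lam)) P := (h1.add (integrable_const _)).const_mul c
  calc ∫ ω, risk μ f fs (lamHat ω) ∂P
      ≤ ∫ ω, (c * (centeredResidual f fs (fun i => Z i ω) lam + hardPenalty n K₁ lam) + R ω) ∂P := by
        refine integral_mono_ae hint (h3.add hR) ?_
        filter_upwards [hlse] with ω hω
        have h4 := hdom ω _ hω.1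
        have h5 := mul_le_mul_of_nonneg_left
          (hω.centeredResidual_le (z := fun i => Z i ω) hK hlam) hc
        linarith
    _ = _ := by
        rw [integral_add h3 hR, integral_const_mul, integral_add h1 (integrable_const _), h2]
        simp

end Sample

/-! ### Fast rate: self-bounded deviations and a net of the ball. -/

section FastRate

variable {S : Type*} [MeasurableSpace S] {μ : Measure S} [IsProbabilityMeasure μ] {n M : ℕ}
  {f : S → ℝ} {fs : Fin M → S → ℝ} {L T : ℝ} {v : ℝ≥0} {Ω : Type*} [MeasurableSpace Ω]
  {P : Measure Ω} [IsProbabilityMeasure P] {Z : Fin n → Ω → S × ℝ}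

/-- For a small enough `t`, the variable `g² - (1 + ε)(g² - 2 w g)` centered suitably has
exponential moment at most one. -/
theorem integral_exp_neg_sq_le {g : S → ℝ} (hg : Measurable g) {G : ℝ} (hG : ∀ x, |g x| ≤ G)
    (hv : 0 < v) {ε : ℝ} (hε : 0 < ε) {t : ℝ}
    (ht : t = ε / ((1 + ε) ^ 2 * (2 * v + G ^ 2 / 2))) :
    ∫ x, Real.exp ((t * (∫ y, g y ^ 2 ∂μ) - t * (1 + ε) * g x ^ 2) +
      v * (2 * t * (1 + ε) * g x) ^ 2 / 2) ∂μ ≤ 1 := by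
  have hv' : (0 : ℝ) < v := by exact_mod_cast hv
  have hD : 0 < 2 * (v : ℝ) + G ^ 2 / 2 := by positivity
  -- The Gaussian variance term is 2vu²g², so the exponent becomes tq - αg² with q = ∫ g² and α =
  -- u(1 - 2vu).
  set u := t * (1 + ε) with hu
  have hu0 : 0 < u := by rw [hu, ht]; positivity
  have huD : u * (2 * v + G ^ 2 / 2) = ε / (1 + ε) := by
    rw [hu, ht]; field_simp
  have hlt : ε / (1 + ε) < 1 := by rw [div_lt_one (by positivity)]; linarith
  have hG2 : 0 ≤ G ^ 2 := sq_nonneg G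
  set α := u * (1 - 2 * v * u) with hα
  have huv : 2 * v * u ≤ 1 := by nlinarith [mul_nonneg hu0.le hG2]
  have hα0 : 0 ≤ α := mul_nonneg hu0.le (by linarith)
  have hαu : α ≤ u := by
    rw [hα]; nlinarith [mul_pos hv' hu0, mul_pos (mul_pos hv' hu0) hu0]
  -- The value of t is tuned to make u(2v + G²/2) = ε/(1+ε), hence t = u/(1+ε) = u(1 - u(2v +
  -- G²/2)). Then E exp(-αg²) ≤ 1 - α(1 - αG²/2)q ≤ 1 - tq ≤ exp(-tq).
  have hkey : t ≤ α * (1 - α * G ^ 2 / 2) := by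
    have h1 : t = u * (1 - u * (2 * v + G ^ 2 / 2)) := by
      rw [huD, hu]; field_simp; ring
    have h2 : 1 - u * G ^ 2 / 2 ≤ 1 - α * G ^ 2 / 2 := by
      have := mul_le_mul_of_nonneg_right hαu hG2
      linarith
    calc t ≤ α * (1 - u * G ^ 2 / 2) := by
          rw [hα, mul_assoc]
          refine h1.le.trans (mul_le_mul_of_nonneg_left ?_ hu0.le)
          have : 0 ≤ (2 * v * u) * (u * G ^ 2 / 2) := by positivity
          linarith
      _ ≤ _ := mul_le_mul_of_nonneg_left h2 hα0
  have hsqle : ∀ x, g x ^ 2 ≤ G ^ 2 := fun x => sq_le_sq' (abs_le.1 (hG x)).1 (abs_le.1 (hG x)).2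
  have hsq : Integrable (fun x => g x ^ 2) μ :=
    Integrable.of_bound (by fun_prop) (G ^ 2) (Filter.Eventually.of_forall fun x => by
      rw [Real.norm_eq_abs, abs_of_nonneg (sq_nonneg _)]; exact hsqle x)
  set q := ∫ y, g y ^ 2 ∂μ
  have hq : 0 ≤ q := integral_nonneg fun _ => sq_nonneg _
  have hexp : Integrable (fun x => Real.exp (-(α * g x ^ 2))) μ :=
    Integrable.of_bound (by fun_prop) 1 (Filter.Eventually.of_forall fun x => by
      rw [Real.norm_eq_abs, Real.abs_exp, Real.exp_le_one_iff]
      have := mul_nonneg hα0 (sq_nonneg (g x))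
      linarith)
  have h1 : ∫ x, Real.exp (-(α * g x ^ 2)) ∂μ ≤ 1 - α * (1 - α * G ^ 2 / 2) * q := by
    calc _ ≤ ∫ x, (1 - α * (1 - α * G ^ 2 / 2) * g x ^ 2) ∂μ := by
          refine integral_mono hexp ((integrable_const _).sub (hsq.const_mul _)) fun x => ?_
          have h2 := exp_neg_le_quadratic (mul_nonneg hα0 (sq_nonneg (g x)))
          have h3 : (α * g x ^ 2) ^ 2 ≤ α ^ 2 * (G ^ 2 * g x ^ 2) := by
            have := mul_le_mul_of_nonneg_left
              (mul_le_mul_of_nonneg_right (hsqle x) (sq_nonneg (g x))) (sq_nonneg α)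
            nlinarith
          simp only
          nlinarith
      _ = _ := by
          rw [integral_sub (integrable_const _) (hsq.const_mul _), integral_const_mul]
          simp [q]
  have h4 : ∀ x, Real.exp ((t * q - u * g x ^ 2) + v * (2 * t * (1 + ε) * g x) ^ 2 / 2) =
      Real.exp (t * q) * Real.exp (-(α * g x ^ 2)) := by
    intro x
    rw [← Real.exp_add]
    congr 1
    have : 2 * t * (1 + ε) * g x = 2 * u * g x := by rw [hu]; ring
    rw [this, hα]; ring
  simp_rw [h4, integral_const_mul]
  have h5 : ∫ x, Real.exp (-(α * g x ^ 2)) ∂μ ≤ Real.exp (-(t * q)) := by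
    refine h1.trans ?_
    have h6 := Real.add_one_le_exp (-(t * q))
    have h7 := mul_le_mul_of_nonneg_right hkey hq
    linarith
  calc Real.exp (t * q) * ∫ x, Real.exp (-(α * g x ^ 2)) ∂μ
      ≤ Real.exp (t * q) * Real.exp (-(t * q)) := by gcongr
    _ = 1 := by rw [← Real.exp_add]; simp

theorem integrable_exp_risk_sub (hL : 0 ≤ L) (hfm : Measurable f)
    (hfsm : ∀ j, Measurable (fs j)) (hf : ∀ x, |f x| ≤ L) (hfs : ∀ j x, |fs j x| ≤ L)
    (hn : 1 ≤ n) (hZ : ∀ i, HasLaw (Z i) (μ.prod (gaussianReal 0 v)) P)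
    (hindep : iIndepFun Z P) (hv : 0 < v) {ε : ℝ} (hε : 0 < ε) {t : ℝ}
    (ht : t = ε / ((1 + ε) ^ 2 * (2 * v + ((T + 1) * L) ^ 2 / 2)))
    {lam : Fin M → ℝ} (hlam : lam ∈ l1Ball M T) :
    Integrable (fun ω => Real.exp (t * n * (risk μ f fs lam -
      (1 + ε) * centeredResidual f fs (fun i => Z i ω) lam))) P ∧
    ∫ ω, Real.exp (t * n * (risk μ f fs lam -
      (1 + ε) * centeredResidual f fs (fun i => Z i ω) lam)) ∂P ≤ 1 := by
  set g : S → ℝ := fun x => comb fs lam x - f x with hgdef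
  have hgm : Measurable g := by fun_prop
  have hG : ∀ x, |g x| ≤ (T + 1) * L := abs_comb_sub_le hL hf hfs hlam
  have hsqle : ∀ x, g x ^ 2 ≤ ((T + 1) * L) ^ 2 :=
    fun x => sq_le_sq' (abs_le.1 (hG x)).1 (abs_le.1 (hG x)).2
  set q := risk μ f fs lam
  obtain ⟨h1, h2⟩ := integrable_exp_affine_gaussian (μ := μ) v
    (a := fun x => t * q - t * (1 + ε) * g x ^ 2) (b := fun x => 2 * t * (1 + ε) * g x)
    (by fun_prop) (by fun_prop) (A := |t * q| + |t * (1 + ε)| * ((T + 1) * L) ^ 2)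
    (B := |2 * t * (1 + ε)| * ((T + 1) * L))
    (fun x => by
      refine (abs_sub _ _).trans ?_
      rw [abs_mul (t * (1 + ε)), abs_of_nonneg (sq_nonneg (g x))]
      have := mul_le_mul_of_nonneg_left (hsqle x) (abs_nonneg (t * (1 + ε)))
      linarith)
    (fun x => by rw [abs_mul]; exact mul_le_mul_of_nonneg_left (hG x) (abs_nonneg _))
  have h3 := integral_exp_neg_sq_le (μ := μ) hgm hG hv hε ht
  have h4 := integrable_exp_sum_iid hZ hindep (by fun_prop) h1 (h2.trans_le h3)
  have h5 : ∀ ω, ∑ i, ((t * q - t * (1 + ε) * g (Z i ω).1 ^ 2) +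
      2 * t * (1 + ε) * g (Z i ω).1 * (Z i ω).2) =
      t * n * (q - (1 + ε) * centeredResidual f fs (fun i => Z i ω) lam) := by
    intro ω
    have hn0 : (n : ℝ) ≠ 0 := by positivity
    have h6 : (n : ℝ) * centeredResidual f fs (fun i => Z i ω) lam =
        ∑ i, (g (Z i ω).1 ^ 2 - 2 * (Z i ω).2 * g (Z i ω).1) := by
      unfold centeredResidual
      rw [← mul_assoc, mul_one_div_cancel hn0, one_mul]
    calc _ = ∑ i : Fin n, (t * q - t * (1 + ε) * (g (Z i ω).1 ^ 2 -
          2 * (Z i ω).2 * g (Z i ω).1)) := Finset.sum_congr rfl fun i _ => by ring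
      _ = n * (t * q) - t * (1 + ε) * (n * centeredResidual f fs (fun i => Z i ω) lam) := by
          rw [Finset.sum_sub_distrib, h6, Finset.mul_sum]
          simp only [Finset.sum_const, Finset.card_univ, Fintype.card_fin, nsmul_eq_mul]
      _ = _ := by ring
  simpa only [h5] using h4

/-- A finite net of the `ℓ₁`-ball at distance `M / n²` of at most `(4 T n²)^M` points. -/
theorem exists_finset_net (hT : 1 ≤ T) (hn : 1 ≤ n) (hM : M ≤ n) :
    ∃ N : Finset (Fin M → ℝ), N.Nonempty ∧ (N.card : ℝ) ≤ (4 * T * n ^ 2) ^ M ∧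
      (∀ theta ∈ N, theta ∈ l1Ball M (T + 1)) ∧
      ∀ lam ∈ l1Ball M T, ∃ theta ∈ N, ∑ j, |lam j - theta j| ≤ 1 / n := by
  classical
  have hn1 : (1 : ℝ) ≤ n := by exact_mod_cast hn
  have hMn : (M : ℝ) ≤ n := by exact_mod_cast hM
  have hn2 : (0 : ℝ) < (n : ℝ) ^ 2 := by positivity
  set K : Finset ℤ := Finset.Icc ⌊-(T * n ^ 2 : ℝ)⌋ ⌊(T * n ^ 2 : ℝ)⌋ with hK
  set G : Finset (Fin M → ℝ) := (Fintype.piFinset fun _ : Fin M => K).image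
    (fun k j => (k j : ℝ) / n ^ 2) with hGdef
  set N := G.filter (fun theta => theta ∈ l1Ball M (T + 1)) with hNdef
  have hnet : ∀ lam ∈ l1Ball M T, ∃ theta ∈ N, ∑ j, |lam j - theta j| ≤ 1 / n := by
    intro lam hlam
    -- Each coordinate is rounded down to a multiple of 1/n². This moves λ by at most M/n² ≤ 1/n in
    -- ℓ₁, possibly out of the ball, whence the radius T + 1 for the net.
    set theta : Fin M → ℝ := fun j => (⌊lam j * n ^ 2⌋ : ℝ) / n ^ 2 with hth
    have hclose : ∀ j, |lam j - theta j| ≤ 1 / n ^ 2 := by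
      intro j
      have h1 := Int.floor_le (lam j * n ^ 2)
      have h2 := Int.lt_floor_add_one (lam j * (n : ℝ) ^ 2)
      have h3 : lam j - theta j = (lam j * n ^ 2 - ⌊lam j * n ^ 2⌋) / n ^ 2 := by
        rw [hth]; field_simp
      rw [h3, abs_of_nonneg (div_nonneg (by linarith) hn2.le)]
      gcongr
      linarith
    have hsum : ∑ j, |lam j - theta j| ≤ 1 / n := by
      calc ∑ j, |lam j - theta j| ≤ ∑ _j : Fin M, 1 / (n : ℝ) ^ 2 :=
            Finset.sum_le_sum fun j _ => hclose j
        _ = M * (1 / (n : ℝ) ^ 2) := by simp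
        _ ≤ n * (1 / (n : ℝ) ^ 2) := by gcongr
        _ = 1 / n := by field_simp
    refine ⟨theta, Finset.mem_filter.2 ⟨Finset.mem_image.2 ⟨fun j => ⌊lam j * n ^ 2⌋, ?_, rfl⟩, ?_⟩,
      hsum⟩
    · refine Fintype.mem_piFinset.2 fun j => Finset.mem_Icc.2 ?_
      have h1 : |lam j| ≤ T :=
        (Finset.single_le_sum (f := fun j => |lam j|) (fun _ _ => abs_nonneg _)
          (Finset.mem_univ j)).trans hlam
      obtain ⟨h2, h3⟩ := abs_le.1 h1
      constructor
      · refine Int.floor_le_floor ?_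
        have := mul_le_mul_of_nonneg_right h2 hn2.le
        linarith
      · exact Int.floor_le_floor (mul_le_mul_of_nonneg_right h3 hn2.le)
    · have h1 : ∑ j, |theta j| ≤ ∑ j, |lam j| + ∑ j, |lam j - theta j| := by
        rw [← Finset.sum_add_distrib]
        refine Finset.sum_le_sum fun j _ => ?_
        have := abs_sub (lam j) (lam j - theta j)
        rwa [sub_sub_cancel] at this
      have h2 : 1 / (n : ℝ) ≤ 1 := by rw [div_le_one (by positivity)]; exact hn1
      have h3 : ∑ j, |lam j| ≤ T := hlam
      exact mem_l1Ball.2 (by linarith)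
  refine ⟨N, ?_, ?_, fun theta h => (Finset.mem_filter.1 h).2, hnet⟩
  · obtain ⟨theta, h, -⟩ := hnet 0 (mem_l1Ball.2 (by simp; linarith))
    exact ⟨theta, h⟩
  · have hKcard : (K.card : ℝ) ≤ 4 * T * n ^ 2 := by
      have h0 : 1 ≤ T * (n : ℝ) ^ 2 := by nlinarith
      have h1 := Int.floor_le (T * (n : ℝ) ^ 2)
      have h2 := Int.lt_floor_add_one (-(T * (n : ℝ) ^ 2))
      have h3 : ((K.card : ℤ) : ℝ) = ⌊(T * n ^ 2 : ℝ)⌋ + 1 - ⌊-(T * n ^ 2 : ℝ)⌋ := by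
        rw [hK, Int.card_Icc, Int.toNat_of_nonneg]
        · push_cast; ring
        · have := Int.floor_le_floor (show -(T * (n : ℝ) ^ 2) ≤ T * n ^ 2 by linarith)
          omega
      rw [Int.cast_natCast] at h3
      rw [h3]
      linarith
    have h1 : N.card ≤ K.card ^ M := by
      calc N.card ≤ G.card := Finset.card_filter_le _ _
        _ ≤ (Fintype.piFinset fun _ : Fin M => K).card := Finset.card_image_le
        _ = K.card ^ M := by simp [Fintype.card_piFinset]
    calc (N.card : ℝ) ≤ (K.card : ℝ) ^ M := by exact_mod_cast h1
      _ ≤ _ := by gcongr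

-- Factor a² - b² = (a + b)(a - b): the sum is at most 2(T+1)L and the difference at most Lδ in
-- absolute value.
omit [MeasurableSpace S] in
theorem sq_comb_sub_le (hL : 0 ≤ L) (hf : ∀ x, |f x| ≤ L) (hfs : ∀ j x, |fs j x| ≤ L)
    {lam theta : Fin M → ℝ} (hlam : lam ∈ l1Ball M T) (htheta : theta ∈ l1Ball M T) {δ : ℝ}
    (hδ : ∑ j, |lam j - theta j| ≤ δ) (x : S) :
    (comb fs lam x - f x) ^ 2 ≤ (comb fs theta x - f x) ^ 2 + 2 * ((T + 1) * L) * (L * δ) := by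
  have h1 := abs_comb_sub_le hL hf hfs hlam x
  have h2 := abs_comb_sub_le hL hf hfs htheta x
  have h3 : |comb fs lam x - comb fs theta x| ≤ L * δ := by
    rw [comb_sub]
    exact (abs_comb_le hfs _ x).trans (mul_le_mul_of_nonneg_left hδ hL)
  have h4 : |comb fs lam x - f x + (comb fs theta x - f x)| ≤ 2 * ((T + 1) * L) :=
    (abs_add_le _ _).trans (by linarith)
  have h5 : (comb fs lam x - f x) ^ 2 - (comb fs theta x - f x) ^ 2 =
      (comb fs lam x - f x + (comb fs theta x - f x)) * (comb fs lam x - comb fs theta x) := by ring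
  have h6 := mul_le_mul h4 h3 (abs_nonneg _) ((abs_nonneg _).trans h4)
  rw [← abs_mul, ← h5] at h6
  linarith [le_abs_self ((comb fs lam x - f x) ^ 2 - (comb fs theta x - f x) ^ 2)]

theorem risk_le_add (hL : 0 ≤ L) (hfm : Measurable f) (hfsm : ∀ j, Measurable (fs j))
    (hf : ∀ x, |f x| ≤ L) (hfs : ∀ j x, |fs j x| ≤ L)
    {lam theta : Fin M → ℝ} (hlam : lam ∈ l1Ball M T) (htheta : theta ∈ l1Ball M T) {δ : ℝ}
    (hδ : ∑ j, |lam j - theta j| ≤ δ) :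
    risk μ f fs lam ≤ risk μ f fs theta + 2 * ((T + 1) * L) * (L * δ) := by
  have h1 := integrable_comb_sub_sq (μ := μ) hL hfm hfsm hf hfs
  have h := integral_mono (μ := μ) (h1 lam) ((h1 theta).add (integrable_const _))
    (sq_comb_sub_le hL hf hfs hlam htheta hδ)
  simp only [Pi.add_apply] at h
  rw [integral_add (h1 theta) (integrable_const _)] at h
  simpa [risk] using h

-- The noise is unbounded, so the Lipschitz constant is random; 2|w| ≤ 1 + w² makes it an average
-- with a finite mean.
omit [MeasurableSpace S] in
theorem centeredResidual_le_add (hn : 1 ≤ n) (hL : 0 ≤ L) (hf : ∀ x, |f x| ≤ L)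
    (hfs : ∀ j x, |fs j x| ≤ L)
    {lam theta : Fin M → ℝ} (hlam : lam ∈ l1Ball M T) (htheta : theta ∈ l1Ball M T) {δ : ℝ}
    (hδ : ∑ j, |lam j - theta j| ≤ δ) (z : Fin n → S × ℝ) :
    centeredResidual f fs z lam ≤ centeredResidual f fs z theta +
      (2 * ((T + 1) * L) * (L * δ) + L * δ * ((1 / (n : ℝ)) * ∑ i, (1 + (z i).2 ^ 2))) := by
  have hn0 : (n : ℝ) ≠ 0 := by positivity
  have h1 : ∀ i, (comb fs lam (z i).1 - f (z i).1) ^ 2 -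
      2 * (z i).2 * (comb fs lam (z i).1 - f (z i).1) ≤
      ((comb fs theta (z i).1 - f (z i).1) ^ 2 -
      2 * (z i).2 * (comb fs theta (z i).1 - f (z i).1)) +
      (2 * ((T + 1) * L) * (L * δ) + L * δ * (1 + (z i).2 ^ 2)) := by
    intro i
    have h2 := sq_comb_sub_le hL hf hfs hlam htheta hδ (z i).1
    have h3 : |comb fs lam (z i).1 - comb fs theta (z i).1| ≤ L * δ := by
      rw [comb_sub]
      exact (abs_comb_le hfs _ _).trans (mul_le_mul_of_nonneg_left hδ hL)
    have h4 : |2 * (z i).2| ≤ 1 + (z i).2 ^ 2 := by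
      rw [abs_le]; constructor <;> nlinarith [sq_nonneg ((z i).2 - 1), sq_nonneg ((z i).2 + 1)]
    have h5 := mul_le_mul h4 h3 (abs_nonneg _) ((abs_nonneg _).trans h4)
    rw [← abs_mul] at h5
    have h6 := neg_abs_le (2 * (z i).2 * (comb fs lam (z i).1 - comb fs theta (z i).1))
    linarith
  have h2 := Finset.sum_le_sum fun i (_ : i ∈ Finset.univ) => h1 i
  have h4 : ∑ i, L * δ * (1 + (z i).2 ^ 2) = L * δ * ∑ i, (1 + (z i).2 ^ 2) := by
    rw [Finset.mul_sum]
  rw [Finset.sum_add_distrib, Finset.sum_add_distrib, h4] at h2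
  have h3 := mul_le_mul_of_nonneg_left h2 (show (0 : ℝ) ≤ 1 / n by positivity)
  unfold centeredResidual
  refine h3.trans (le_of_eq ?_)
  simp only [Finset.sum_const, Finset.card_univ, Fintype.card_fin, nsmul_eq_mul]
  field_simp

omit [IsProbabilityMeasure P] in
theorem integral_sq_noise (hn : 1 ≤ n)
    (hZ : ∀ i, HasLaw (Z i) (μ.prod (gaussianReal 0 v)) P) :
    Integrable (fun ω => (1 / (n : ℝ)) * ∑ i, (1 + (Z i ω).2 ^ 2)) P ∧
    ∫ ω, (1 / (n : ℝ)) * ∑ i, (1 + (Z i ω).2 ^ 2) ∂P = 1 + (v : ℝ) := by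
  have hw : Integrable (fun w : ℝ => w ^ 2) (gaussianReal 0 v) :=
    (memLp_id_gaussianReal' 2 (by simp)).integrable_sq
  have hw2 : ∫ w, w ^ 2 ∂(gaussianReal 0 v) = v := by
    have h := variance_fun_id_gaussianReal (μ := 0) (v := v)
    rw [variance_eq_integral measurable_id'.aemeasurable] at h
    simpa using h
  have h1 : Integrable (fun z : S × ℝ => 1 + z.2 ^ 2) (μ.prod (gaussianReal 0 v)) :=
    (integrable_const _).add (hw.comp_snd _)
  have h2 : ∫ z, (1 + z.2 ^ 2) ∂(μ.prod (gaussianReal 0 v)) = 1 + (v : ℝ) := by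
    rw [integral_add (integrable_const _) (hw.comp_snd _), integral_fun_snd (fun w : ℝ => w ^ 2),
      hw2]
    simp
  have h3 : ∀ i, Integrable (fun ω => 1 + (Z i ω).2 ^ 2) P := by
    intro i
    have := h1
    rw [← (hZ i).map_eq] at this
    exact this.comp_aemeasurable (hZ i).aemeasurable
  have h4 : ∀ i, ∫ ω, (1 + (Z i ω).2 ^ 2) ∂P = 1 + (v : ℝ) := by
    intro i
    rw [← h2]
    exact (hZ i).integral_comp h1.aestronglyMeasurable
  refine ⟨(integrable_finsetSum _ fun i _ => h3 i).const_mul _, ?_⟩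
  rw [integral_const_mul, integral_finsetSum _ fun i _ => h3 i]
  simp only [h4, Finset.sum_const, Finset.card_univ, Fintype.card_fin, nsmul_eq_mul]
  have : (n : ℝ) ≠ 0 := by positivity
  field_simp

/-- The constant of the parametric rate. -/
noncomputable def fastConst (L T v : ℝ) : ℝ :=
  2 * (2 + Real.log (4 * T)) * (2 * v + ((T + 2) * L) ^ 2 / 2) +
    2 * (2 * ((T + 2) * L) * L + L * (1 + v))

/-- Uniform control of the risk over the `ℓ₁`-ball at the parametric rate `M log n / n`. -/
theorem exists_dominating_fast (hL : 0 ≤ L) (hT : 1 ≤ T) (hfm : Measurable f)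
    (hfsm : ∀ j, Measurable (fs j)) (hf : ∀ x, |f x| ≤ L) (hfs : ∀ j x, |fs j x| ≤ L)
    (hn : 3 ≤ n) (hM : 1 ≤ M) (hMn : M ≤ n)
    (hZ : ∀ i, HasLaw (Z i) (μ.prod (gaussianReal 0 v)) P)
    (hindep : iIndepFun Z P) (hv : 0 < v) {ε : ℝ} (hε : 0 < ε) :
    ∃ R : Ω → ℝ, Integrable R P ∧
      ∫ ω, R ω ∂P ≤ fastConst L T v * (1 + ε + ε⁻¹) * (M * Real.log n / n) ∧
      ∀ ω, ∀ lam ∈ l1Ball M T,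
        risk μ f fs lam - (1 + ε) * centeredResidual f fs (fun i => Z i ω) lam ≤ R ω := by
  obtain ⟨N, hne, hcard, hNball, hnet⟩ := exists_finset_net (M := M) hT (by omega : 1 ≤ n) hMn
  have hn1 : 1 ≤ n := by omega
  have hnpos : (0 : ℝ) < n := by positivity
  have hv' : (0 : ℝ) < v := by exact_mod_cast hv
  set G := (T + 2) * L with hGdef
  have hG0 : 0 ≤ G := mul_nonneg (by linarith) hL
  have hTG : (T + 1 + 1) * L = G := by rw [hGdef]; ring
  set t := ε / ((1 + ε) ^ 2 * (2 * v + G ^ 2 / 2)) with ht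
  have hD : 0 < 2 * (v : ℝ) + G ^ 2 / 2 := by positivity
  have htpos : 0 < t := by rw [ht]; positivity
  have hexp := fun theta (h : theta ∈ N) => integrable_exp_risk_sub (T := T + 1) hL hfm hfsm hf hfs
    hn1 hZ hindep hv hε (t := t) (by rw [hTG]) (hNball theta h)
  obtain ⟨R, hR, hRint, hRdom⟩ := exists_integrable_dominating N hne
    (fun theta ω => t * n * (risk μ f fs theta -
      (1 + ε) * centeredResidual f fs (fun i => Z i ω) theta))
    (fun theta h => (hexp theta h).1) (fun theta h => (hexp theta h).2)
  obtain ⟨hA, hAint⟩ := integral_sq_noise (μ := μ) (v := v) hn1 hZ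
  set A : Ω → ℝ := fun ω => (1 / (n : ℝ)) * ∑ i, (1 + (Z i ω).2 ^ 2)
  have htn : 0 < t * n := by positivity
  have hsub : ∀ lam ∈ l1Ball M T, lam ∈ l1Ball M (T + 1) := fun lam h =>
    mem_l1Ball.2 ((mem_l1Ball.1 h).trans (by linarith))
  have i1 : Integrable (fun ω => R ω / (t * n)) P := hR.div_const _
  have i2 : Integrable (fun ω => L * (1 / n) * A ω) P := hA.const_mul _
  have i3 : Integrable (fun ω => (1 + ε) * (2 * G * (L * (1 / n)) + L * (1 / n) * A ω)) P :=
    ((integrable_const _).add i2).const_mul _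
  have i4 : Integrable (fun ω => 2 * G * (L * (1 / n)) +
    (1 + ε) * (2 * G * (L * (1 / n)) + L * (1 / n) * A ω)) P := (integrable_const _).add i3
  have e3 : ∫ ω, (1 + ε) * (2 * G * (L * (1 / n)) + L * (1 / n) * A ω) ∂P =
      (1 + ε) * (2 * G * (L * (1 / n)) + L * (1 / n) * (1 + v)) := by
    rw [integral_const_mul, integral_add (integrable_const _) i2, integral_const_mul (L * (1 / (n : ℝ))) A, hAint]
    simp
  refine ⟨fun ω => R ω / (t * n) + (2 * G * (L * (1 / n)) +
    (1 + ε) * (2 * G * (L * (1 / n)) + L * (1 / n) * A ω)), ?_, ?_, ?_⟩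
  · exact i1.add i4
  · rw [integral_add i1 i4, integral_add (integrable_const _) i3, integral_div, e3]
    simp only [integral_const, probReal_univ, smul_eq_mul, one_mul]
    -- As n ≥ 3 > e, constants and the O(1/n) discretization error are absorbed in M log n / n.
    have hlogn : 1 ≤ Real.log n := by
      rw [Real.le_log_iff_exp_le hnpos]
      have : (3 : ℝ) ≤ n := by exact_mod_cast hn
      linarith [Real.exp_one_lt_d9]
    have hlogT : 0 ≤ Real.log (4 * T) := Real.log_nonneg (by linarith)
    have hM1 : (1 : ℝ) ≤ M := by exact_mod_cast hM
    have hMlog : 1 ≤ M * Real.log n := by nlinarith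
    have hlogN : Real.log N.card ≤ M * Real.log n * (2 + Real.log (4 * T)) := by
      have h1 : Real.log N.card ≤ M * (Real.log (4 * T) + 2 * Real.log n) := by
        refine (Real.log_le_log (by exact_mod_cast hne.card_pos) hcard).trans (le_of_eq ?_)
        rw [Real.log_pow, Real.log_mul (by positivity) (by positivity), Real.log_pow]
        norm_num
      have h2 : (M : ℝ) * Real.log (4 * T) * 1 ≤ M * Real.log (4 * T) * Real.log n := by gcongr
      linarith
    -- The factor ε⁻¹ of the bound arises here, from (1+ε)²/ε = 2 + ε + ε⁻¹.
    have hti : 1 / (t * n) ≤ 2 * (1 + ε + ε⁻¹) * (2 * v + G ^ 2 / 2) / n := by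
      have h1 : 1 / (t * n) = (2 + ε + ε⁻¹) * (2 * v + G ^ 2 / 2) / n := by
        rw [ht]; field_simp; ring
      rw [h1]
      gcongr
      have : 0 < ε⁻¹ := by positivity
      linarith
    have hE : 0 < 1 + ε + ε⁻¹ := by positivity
    have hfirst : (∫ ω, R ω ∂P) / (t * n) ≤ 2 * (2 + Real.log (4 * T)) *
        (2 * v + G ^ 2 / 2) * (1 + ε + ε⁻¹) * (M * Real.log n / n) := by
      calc (∫ ω, R ω ∂P) / (t * n) ≤ (M * Real.log n * (2 + Real.log (4 * T))) * (1 / (t * n)) := by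
            rw [div_eq_mul_one_div]
            exact mul_le_mul_of_nonneg_right (hRint.trans hlogN) (by positivity)
        _ ≤ (M * Real.log n * (2 + Real.log (4 * T))) *
            (2 * (1 + ε + ε⁻¹) * (2 * v + G ^ 2 / 2) / n) :=
            mul_le_mul_of_nonneg_left hti (by positivity)
        _ = _ := by ring
    have hsecond : 2 * G * (L * (1 / n)) + (1 + ε) * (2 * G * (L * (1 / n)) +
        L * (1 / n) * (1 + v)) ≤ 2 * (2 * G * L + L * (1 + v)) * (1 + ε + ε⁻¹) *
        (M * Real.log n / n) := by
      have hQ : 0 ≤ 2 * G * L + L * (1 + v) := by positivity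
      have h1 : 0 ≤ 2 * G * L * ε := by positivity
      have h2 : 0 ≤ L * (1 + (v : ℝ)) * (1 + ε) := by positivity
      calc _ = (2 * G * L + (1 + ε) * (2 * G * L + L * (1 + v))) * (1 / n) := by ring
        _ ≤ (2 * (2 * G * L + L * (1 + v)) * (1 + ε + ε⁻¹)) * (M * Real.log n / n) := by
            have h3 : 0 ≤ (2 * G * L + L * (1 + v)) * ε⁻¹ := by positivity
            refine mul_le_mul ?_ ?_ (by positivity) (by positivity)
            · nlinarith
            · gcongr
        _ = _ := by ring
    unfold fastConst
    rw [← hGdef]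
    linarith
  · intro ω lam hlam
    obtain ⟨theta, hth, hdist⟩ := hnet lam hlam
    have h1 := risk_le_add (μ := μ) hL hfm hfsm hf hfs (hsub _ hlam) (hNball _ hth) hdist
    have hdist' : ∑ j, |theta j - lam j| ≤ 1 / n := by simpa only [abs_sub_comm] using hdist
    have h2 := centeredResidual_le_add hn1 hL hf hfs (hNball _ hth) (hsub _ hlam) hdist'
      (fun i => Z i ω)
    rw [hTG] at h1 h2
    have h3 : risk μ f fs theta - (1 + ε) * centeredResidual f fs (fun i => Z i ω) theta ≤
        R ω / (t * n) := by
      rw [le_div_iff₀ htn, mul_comm]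
      exact hRdom ω theta hth
    have h4 := mul_le_mul_of_nonneg_left h2 (show (0 : ℝ) ≤ 1 + ε by positivity)
    simp only [A]
    linarith

end FastRate

/-! ### Maurey's sparse approximation, one atom at a time. -/

section Maurey

variable {S : Type*} [MeasurableSpace S] {μ : Measure S} [IsProbabilityMeasure μ] {M : ℕ}
  {f : S → ℝ} {fs : Fin M → S → ℝ} {L : ℝ}

theorem exists_le_weighted_sum {ι : Type*} [Fintype ι] {w I : ι → ℝ} (hw : ∀ i, 0 ≤ w i)
    (hsum : ∑ i, w i = 1) {Q : ℝ} (h : ∑ i, w i * I i ≤ Q) : ∃ i, I i ≤ Q := by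
  by_contra! hlt
  have hpos : ∃ i ∈ Finset.univ, 0 < w i := by
    by_contra! h0
    have : ∑ i, w i ≤ 0 := Finset.sum_nonpos h0
    linarith
  obtain ⟨i, -, hi⟩ := hpos
  have h1 : ∑ i, w i * Q < ∑ i, w i * I i :=
    Finset.sum_lt_sum (fun j _ => mul_le_mul_of_nonneg_left (hlt j).le (hw j))
      ⟨i, Finset.mem_univ i, mul_lt_mul_of_pos_left (hlt i) hi⟩
  rw [← Finset.sum_mul, hsum] at h1
  linarith

/-- One step of Maurey's argument: some atom (or zero) can be added with little increase of the
squared norm. -/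
theorem exists_atom_integral_sq_le (hfsm : ∀ j, Measurable (fs j)) (hfs : ∀ j x, |fs j x| ≤ L) {lam : Fin M → ℝ}
    (hlam : lam ∈ simplex M) {A : S → ℝ} (hA : MemLp A 2 μ) :
    ∃ e : Fin M → ℕ, ∑ j, e j ≤ 1 ∧
      ∫ x, (A x + comb fs (fun j => (e j : ℝ)) x - comb fs lam x) ^ 2 ∂μ ≤
        (∫ x, A x ^ 2 ∂μ) + L ^ 2 := by
  classical
  have hj : ∀ j, MemLp (fs j) 2 μ := fun j =>
    MemLp.of_bound (hfsm j).aestronglyMeasurable L (Filter.Eventually.of_forall fun x => hfs j x)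
  have hcomb : ∀ lam : Fin M → ℝ, MemLp (comb fs lam) 2 μ := fun lam =>
    memLp_finsetSum _ fun j _ => (hj j).const_mul (lam j)
  let e : Option (Fin M) → Fin M → ℕ := fun o => o.elim 0 fun j => Pi.single j 1
  have he : ∀ o, ∑ j, e o j ≤ 1 := by
    rintro (_ | j)
    · simp [e]
    · simp [e]
  have hen : ∀ x, comb fs (fun j => (e none j : ℝ)) x = 0 := fun x => by simp [e, comb]
  have hes : ∀ j x, comb fs (fun k => (e (some j) k : ℝ)) x = fs j x := fun j x => by
    simp [e, comb, Pi.single_apply]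
  -- A random atom equal to f_j with probability λ_j, and to 0 with the remaining mass, has mean
  -- f_λ. Hence the cross term with A averages to zero and the variance is at most L²; some atom
  -- does no worse than the average.
  let w : Option (Fin M) → ℝ := fun o => o.elim (1 - ∑ j, lam j) lam
  have hw : ∀ o, 0 ≤ w o := by
    rintro (_ | j)
    · exact sub_nonneg.2 hlam.2
    · exact hlam.1 j
  have hws : ∑ o, w o = 1 := by rw [Fintype.sum_option]; simp [w]
  have hI : ∀ o, Integrable
      (fun x => (A x + comb fs (fun j => (e o j : ℝ)) x - comb fs lam x) ^ 2) μ := fun o =>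
    ((hA.add (hcomb _)).sub (hcomb lam)).integrable_sq
  obtain ⟨o, ho⟩ := exists_le_weighted_sum hw hws
    (I := fun o => ∫ x, (A x + comb fs (fun j => (e o j : ℝ)) x - comb fs lam x) ^ 2 ∂μ)
    (Q := (∫ x, A x ^ 2 ∂μ) + L ^ 2) (by
      simp_rw [← integral_const_mul]
      rw [← integral_finsetSum _ fun o _ => (hI o).const_mul _]
      have hA2 : Integrable (fun x => A x ^ 2) μ := hA.integrable_sq
      have h1 : (∫ x, A x ^ 2 ∂μ) + L ^ 2 = ∫ x, (A x ^ 2 + L ^ 2) ∂μ := by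
        rw [integral_add hA2 (integrable_const _)]; simp
      rw [h1]
      refine integral_mono (integrable_finsetSum _ fun o _ => (hI o).const_mul _)
        (hA2.add (integrable_const _)) fun x => ?_
      simp only [Fintype.sum_option, hen, hes, w, Option.elim]
      set F := comb fs lam x with hF
      have h2 : ∑ j, lam j * (A x + fs j x - F) ^ 2 =
          (∑ j, lam j) * (A x - F) ^ 2 + 2 * (A x - F) * F + ∑ j, lam j * fs j x ^ 2 := by
        rw [hF, comb, Finset.sum_mul, Finset.mul_sum, ← Finset.sum_add_distrib,
          ← Finset.sum_add_distrib]
        exact Finset.sum_congr rfl fun j _ => by ring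
      have h3 : ∑ j, lam j * fs j x ^ 2 ≤ L ^ 2 := by
        calc ∑ j, lam j * fs j x ^ 2 ≤ ∑ j, lam j * L ^ 2 :=
              Finset.sum_le_sum fun j _ => mul_le_mul_of_nonneg_left
                (sq_le_sq' (abs_le.1 (hfs j x)).1 (abs_le.1 (hfs j x)).2) (hlam.1 j)
          _ = (∑ j, lam j) * L ^ 2 := by rw [Finset.sum_mul]
          _ ≤ 1 * L ^ 2 := mul_le_mul_of_nonneg_right hlam.2 (sq_nonneg L)
          _ = L ^ 2 := one_mul _
      rw [h2]
      nlinarith [sq_nonneg F])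
  exact ⟨e o, he o, ho⟩

/-- **Maurey's lemma**: a convex combination is approximated at the rate `1 / m` by one with at
most `m` non-zero coefficients. -/
theorem exists_sparse_risk_le (hfm : Measurable f)
    (hfsm : ∀ j, Measurable (fs j)) (hf : ∀ x, |f x| ≤ L) (hfs : ∀ j x, |fs j x| ≤ L)
    {lam : Fin M → ℝ} (hlam : lam ∈ simplex M) {m : ℕ} (hm : 1 ≤ m) :
    ∃ theta ∈ simplex M, numNonzero theta ≤ m ∧
      risk μ f fs theta ≤ risk μ f fs lam + L ^ 2 / m := by
  have hm0 : (0 : ℝ) < m := by exact_mod_cast hm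
  have hj : ∀ j, MemLp (fs j) 2 μ := fun j =>
    MemLp.of_bound (hfsm j).aestronglyMeasurable L (Filter.Eventually.of_forall fun x => hfs j x)
  have hf2 : MemLp f 2 μ :=
    MemLp.of_bound hfm.aestronglyMeasurable L (Filter.Eventually.of_forall fun x => hf x)
  have hcomb : ∀ lam : Fin M → ℝ, MemLp (comb fs lam) 2 μ := fun lam =>
    memLp_finsetSum _ fun j _ => (hj j).const_mul (lam j)
  -- After k atoms, the error is m(f_λ - f) plus k increments, each an atom minus f_λ. At k = m it
  -- equals m(f_{c/m} - f), so dividing by m² leaves an excess L²/m.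
  have key : ∀ k : ℕ, ∃ c : Fin M → ℕ, ∑ j, c j ≤ k ∧
      ∫ x, (m * (comb fs lam x - f x) + comb fs (fun j => (c j : ℝ)) x - k * comb fs lam x) ^ 2 ∂μ ≤
        m ^ 2 * risk μ f fs lam + k * L ^ 2 := by
    intro k
    induction k with
    | zero =>
      refine ⟨0, by simp, le_of_eq ?_⟩
      simp [comb, risk, mul_pow, integral_const_mul]
    | succ k ih =>
      obtain ⟨c, hc, hint⟩ := ih
      obtain ⟨e, he, heint⟩ := exists_atom_integral_sq_le (μ := μ) hfsm hfs hlam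
        (A := fun x => m * (comb fs lam x - f x) + comb fs (fun j => (c j : ℝ)) x -
          k * comb fs lam x)
        (((((hcomb lam).sub hf2).const_mul (m : ℝ)).add (hcomb _)).sub ((hcomb lam).const_mul _))
      refine ⟨c + e, ?_, ?_⟩
      · simp only [Pi.add_apply, Finset.sum_add_distrib]
        omega
      · have h1 : ∀ x, comb fs (fun j => ((c + e) j : ℕ) : Fin M → ℝ) x =
            comb fs (fun j => (c j : ℝ)) x + comb fs (fun j => (e j : ℝ)) x := by
          intro x
          simp [comb, add_mul, Finset.sum_add_distrib]
        have h2 : ∀ x, m * (comb fs lam x - f x) + comb fs (fun j => ((c + e) j : ℕ) : Fin M → ℝ) x -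
            ((k + 1 : ℕ) : ℝ) * comb fs lam x = m * (comb fs lam x - f x) +
            comb fs (fun j => (c j : ℝ)) x - k * comb fs lam x + comb fs (fun j => (e j : ℝ)) x -
            comb fs lam x := by
          intro x
          rw [h1]; push_cast; ring
        simp_rw [h2]
        push_cast
        linarith
  obtain ⟨c, hc, hint⟩ := key m
  refine ⟨fun j => c j / m, ⟨fun j => by positivity, ?_⟩, ?_, ?_⟩
  · rw [← Finset.sum_div, div_le_one hm0]
    exact_mod_cast hc
  · refine le_trans ?_ hc
    unfold numNonzero
    rw [Finset.card_eq_sum_ones]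
    calc _ ≤ ∑ j ∈ Finset.univ.filter fun j => (c j : ℝ) / m ≠ 0, c j := by
          refine Finset.sum_le_sum fun j hj => ?_
          have h1 : (c j : ℝ) / m ≠ 0 := (Finset.mem_filter.1 hj).2
          refine Nat.one_le_iff_ne_zero.2 fun h0 => h1 ?_
          rw [h0]; simp
      _ ≤ ∑ j, c j := Finset.sum_le_sum_of_subset (Finset.filter_subset _ _)
  · have h1 : ∀ x, (m * (comb fs lam x - f x) + comb fs (fun j => (c j : ℝ)) x -
        m * comb fs lam x) ^ 2 = m ^ 2 * (comb fs (fun j => (c j : ℝ) / m) x - f x) ^ 2 := by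
      intro x
      have h2 : comb fs (fun j => (c j : ℝ)) x = m * comb fs (fun j => (c j : ℝ) / m) x := by
        simp only [comb, Finset.mul_sum]
        exact Finset.sum_congr rfl fun j _ => by field_simp
      rw [h2]; ring
    simp_rw [h1, integral_const_mul] at hint
    have h3 : (m : ℝ) ^ 2 * risk μ f fs (fun j => (c j : ℝ) / m) ≤
        m ^ 2 * (risk μ f fs lam + L ^ 2 / m) := by
      refine hint.trans (le_of_eq ?_)
      field_simp
    exact le_of_mul_le_mul_left h3 (by positivity)

end Maurey

/-! ### Slow rate: uniform deviations by ℓ₁ duality. -/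

section SlowRate

variable {S : Type*} [MeasurableSpace S] {μ : Measure S} [IsProbabilityMeasure μ] {n M : ℕ}
  {f : S → ℝ} {fs : Fin M → S → ℝ} {L T : ℝ} {v : ℝ≥0} {Ω : Type*} [MeasurableSpace Ω]
  {P : Measure Ω} [IsProbabilityMeasure P] {Z : Fin n → Ω → S × ℝ}

/-- Maximal inequality for averages of sub-Gaussian variables. -/
theorem exists_dominating_abs_average {R : Type*} [MeasurableSpace R] {ν : Measure R}
    [IsProbabilityMeasure ν] {Z : Fin n → Ω → R} (hn : 1 ≤ n) (hZ : ∀ i, HasLaw (Z i) ν P)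
    (hindep : iIndepFun Z P) {κ : Type*} [Fintype κ] [Nonempty κ] {ψ : κ → R → ℝ}
    (hψm : ∀ k, Measurable (ψ k)) {c : ℝ≥0} (hψ : ∀ k, HasSubgaussianMGF (ψ k) c ν)
    {s : ℝ} (hs : 0 < s) :
    ∃ B : Ω → ℝ, Integrable B P ∧
      ∫ ω, B ω ∂P ≤ s * c / 2 + Real.log (2 * Fintype.card κ) / (s * n) ∧
      ∀ ω k, |(1 / (n : ℝ)) * ∑ i, ψ k (Z i ω)| ≤ B ω := by
  have hn0 : (0 : ℝ) < n := by positivity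
  -- Both signs of each average enter the family, which turns the maximal inequality into one for
  -- absolute values and costs the factor 2 in the logarithm.
  let sg : Bool → ℝ := fun b => if b then 1 else -1
  have hsg : ∀ b, sg b ^ 2 = 1 := by intro b; cases b <;> simp [sg]
  let φ : Bool × κ → R → ℝ := fun p z => sg p.1 * s * ψ p.2 z + -(c * s ^ 2 / 2)
  have hφm : ∀ p, Measurable (φ p) := fun p => ((hψm p.2).const_mul _).add_const _
  have hφ : ∀ p, Integrable (fun z => Real.exp (φ p z)) ν ∧ ∫ z, Real.exp (φ p z) ∂ν ≤ 1 := by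
    intro p
    have h1 := (hψ p.2).integrable_exp_mul (sg p.1 * s)
    have h2 := (hψ p.2).mgf_le (sg p.1 * s)
    simp only [φ, Real.exp_add]
    refine ⟨h1.mul_const _, ?_⟩
    rw [integral_mul_const]
    rw [mul_pow, hsg, one_mul] at h2
    calc _ ≤ Real.exp (c * s ^ 2 / 2) * Real.exp (-(c * s ^ 2 / 2)) := by gcongr; exact h2
      _ = 1 := by rw [← Real.exp_add]; simp
  have hsum : ∀ p ω, ∑ i, φ p (Z i ω) = s * n * (sg p.1 * ((1 / (n : ℝ)) * ∑ i, ψ p.2 (Z i ω)) -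
      s * c / 2) := by
    intro p ω
    simp only [φ]
    rw [Finset.sum_add_distrib, ← Finset.mul_sum]
    simp only [Finset.sum_const, Finset.card_univ, Fintype.card_fin, nsmul_eq_mul]
    field_simp
    ring
  obtain ⟨B, hB, hBint, hdom⟩ := exists_integrable_dominating (P := P)
    (Finset.univ : Finset (Bool × κ)) Finset.univ_nonempty (fun p ω => ∑ i, φ p (Z i ω))
    (fun p _ => (integrable_exp_sum_iid hZ hindep (hφm p) (hφ p).1 (hφ p).2).1)
    (fun p _ => (integrable_exp_sum_iid hZ hindep (hφm p) (hφ p).1 (hφ p).2).2)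
  have hsn : 0 < s * n := by positivity
  refine ⟨fun ω => s * c / 2 + B ω / (s * n), (integrable_const _).add (hB.div_const _), ?_, ?_⟩
  · rw [integral_add (integrable_const _) (hB.div_const _), integral_div (s * n)]
    have h1 : (∫ ω, B ω ∂P) / (s * n) ≤ Real.log (2 * Fintype.card κ) / (s * n) := by
      gcongr
      simpa using hBint
    simpa using h1
  · intro ω k
    have h1 : ∀ b, sg b * ((1 / (n : ℝ)) * ∑ i, ψ k (Z i ω)) ≤ s * c / 2 + B ω / (s * n) := by
      intro b
      have h2 := hdom ω (b, k) (Finset.mem_univ _)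
      rw [hsum, mul_comm, ← le_div_iff₀ hsn] at h2
      linarith
    have h3 := h1 true
    have h4 := h1 false
    simp only [sg] at h3 h4
    rw [abs_le]
    constructor <;> norm_num at h3 h4 ⊢ <;> linarith

theorem hasSubgaussianMGF_mean_sub {g : S → ℝ} (hg : Measurable g) {B : ℝ≥0}
    (hB : ∀ x, |g x| ≤ B) (ρ : Measure ℝ) [IsProbabilityMeasure ρ] :
    HasSubgaussianMGF (fun z : S × ℝ => (∫ x, g x ∂μ) - g z.1) (B ^ 2) (μ.prod ρ) := by
  have h1 := hasSubgaussianMGF_of_mem_Icc (μ := μ.prod ρ) (X := fun z : S × ℝ => g z.1)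
    (a := -(B : ℝ)) (b := B) (by fun_prop) (Filter.Eventually.of_forall fun z => abs_le.1 (hB z.1))
  have h2 : ∫ z, g z.1 ∂(μ.prod ρ) = ∫ x, g x ∂μ := by
    rw [integral_fun_fst]; simp
  have h3 : (‖(B : ℝ) - -(B : ℝ)‖₊ / 2) = B := by
    ext
    simp only [sub_neg_eq_add, NNReal.coe_div, coe_nnnorm, Real.norm_eq_abs, NNReal.coe_ofNat]
    rw [abs_of_nonneg (by positivity)]
    ring
  rw [h3] at h1
  have h4 := h1.neg
  simp only [h2] at h4
  convert h4 using 1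
  funext z
  simp

/-- Given the design point, the product is Gaussian with variance v g² ≤ v B². -/
theorem hasSubgaussianMGF_noise_mul {g : S → ℝ} (hg : Measurable g) {B : ℝ≥0}
    (hB : ∀ x, |g x| ≤ B) :
    HasSubgaussianMGF (fun z : S × ℝ => g z.1 * z.2) (v * B ^ 2)
      (μ.prod (gaussianReal 0 v)) := by
  have key := fun t : ℝ => integrable_exp_affine_gaussian (μ := μ) v
    (a := fun _ => 0) (b := fun x => t * g x) (by fun_prop) (by fun_prop) (A := 0) (B := |t| * B)
    (fun x => by simp)
    (fun x => by rw [abs_mul]; exact mul_le_mul_of_nonneg_left (hB x) (abs_nonneg _))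
  simp only [zero_add, mul_assoc] at key
  refine ⟨fun t => (key t).1, fun t => ?_⟩
  have h2 : ∀ x, v * (t * g x) ^ 2 / 2 ≤ ((v * B ^ 2 : ℝ≥0) : ℝ) * t ^ 2 / 2 := by
    intro x
    have h3 : g x ^ 2 ≤ (B : ℝ) ^ 2 := sq_le_sq' (abs_le.1 (hB x)).1 (abs_le.1 (hB x)).2
    push_cast
    rw [mul_pow, mul_comm (t ^ 2), ← mul_assoc]
    gcongr
  simp only [mgf]
  rw [(key t).2]
  have h4 : Integrable (fun x => Real.exp (v * (t * g x) ^ 2 / 2)) μ :=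
    Integrable.of_bound (by fun_prop) (Real.exp (((v * B ^ 2 : ℝ≥0) : ℝ) * t ^ 2 / 2))
      (Filter.Eventually.of_forall fun x => by
        rw [Real.norm_eq_abs, Real.abs_exp]
        exact Real.exp_le_exp.2 (h2 x))
  have h5 := integral_mono h4 (integrable_const _) fun x => Real.exp_le_exp.2 (h2 x)
  simpa using h5

/-- The decomposition of the deviation of the centered residual from the risk. -/
theorem risk_sub_centeredResidual_le {κ : Type*} [Fintype κ] {F : κ → S → ℝ} {coef : κ → ℝ}
    (hn : 1 ≤ n) (hFm : ∀ k, Measurable (F k)) (hF : ∀ k x, |F k x| ≤ L)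
    {lam : Fin M → ℝ} (hrep : ∀ x, comb fs lam x - f x = ∑ k, coef k * F k x)
    {τ : ℝ} (hcoef : ∑ k, |coef k| ≤ τ) (z : Fin n → S × ℝ) {B₁ B₂ : ℝ}
    (h₁ : ∀ p : κ × κ, |(1 / (n : ℝ)) * ∑ i, ((∫ x, F p.1 x * F p.2 x ∂μ) -
      F p.1 (z i).1 * F p.2 (z i).1)| ≤ B₁)
    (h₂ : ∀ k, |(1 / (n : ℝ)) * ∑ i, F k (z i).1 * (z i).2| ≤ B₂) (hB₁ : 0 ≤ B₁) (hB₂ : 0 ≤ B₂) :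
    risk μ f fs lam - centeredResidual f fs z lam ≤ τ ^ 2 * B₁ + 2 * τ * B₂ := by
  have hn0 : (n : ℝ) ≠ 0 := by positivity
  have hFF : ∀ k l, Integrable (fun x => F k x * F l x) μ := by
    intro k l
    have := hFm k
    have := hFm l
    refine Integrable.of_bound (by fun_prop) (L * L) (Filter.Eventually.of_forall fun x => ?_)
    rw [Real.norm_eq_abs, abs_mul]
    exact mul_le_mul (hF k x) (hF l x) (abs_nonneg _) ((abs_nonneg _).trans (hF k x))
  have hsq : ∀ x, (comb fs lam x - f x) ^ 2 = ∑ k, ∑ l, coef k * coef l * (F k x * F l x) := by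
    intro x
    rw [hrep, sq, Finset.sum_mul_sum]
    exact Finset.sum_congr rfl fun k _ => Finset.sum_congr rfl fun l _ => by ring
  have hrisk : risk μ f fs lam = ∑ k, ∑ l, coef k * coef l * ∫ x, F k x * F l x ∂μ := by
    simp only [risk, hsq]
    rw [integral_finsetSum _ fun k _ => integrable_finsetSum _ fun l _ => (hFF k l).const_mul _]
    simp_rw [integral_finsetSum _ fun l _ => (hFF _ l).const_mul _, integral_const_mul]
  have hres : centeredResidual f fs z lam =
      (∑ k, ∑ l, coef k * coef l * ((1 / (n : ℝ)) * ∑ i, F k (z i).1 * F l (z i).1)) -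
      2 * ∑ k, coef k * ((1 / (n : ℝ)) * ∑ i, F k (z i).1 * (z i).2) := by
    have e1 : ∑ i, (comb fs lam (z i).1 - f (z i).1) ^ 2 =
        ∑ k, ∑ l, coef k * coef l * ∑ i, F k (z i).1 * F l (z i).1 := by
      simp only [hsq, Finset.mul_sum]
      rw [Finset.sum_comm]
      exact Finset.sum_congr rfl fun k _ => Finset.sum_comm
    have e2 : ∑ i, 2 * (z i).2 * (comb fs lam (z i).1 - f (z i).1) =
        2 * ∑ k, coef k * ∑ i, F k (z i).1 * (z i).2 := by
      simp only [hrep, Finset.mul_sum]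
      rw [Finset.sum_comm]
      exact Finset.sum_congr rfl fun k _ => Finset.sum_congr rfl fun i _ => by ring
    unfold centeredResidual
    rw [Finset.sum_sub_distrib, e1, e2, mul_sub]
    congr 1
    · simp only [Finset.mul_sum]
      exact Finset.sum_congr rfl fun k _ => Finset.sum_congr rfl fun l _ =>
        Finset.sum_congr rfl fun i _ => by ring
    · simp only [Finset.mul_sum]
      exact Finset.sum_congr rfl fun k _ => Finset.sum_congr rfl fun i _ => by ring
  -- The deviation is a quadratic form plus a linear form in `coef`; each is bounded by its largest
  -- entry times a power of the ℓ₁-norm, and the entries do not depend on `coef`.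
  have hdiff : risk μ f fs lam - centeredResidual f fs z lam =
      (∑ k, ∑ l, coef k * coef l * ((1 / (n : ℝ)) * ∑ i, ((∫ x, F k x * F l x ∂μ) -
        F k (z i).1 * F l (z i).1))) +
      2 * ∑ k, coef k * ((1 / (n : ℝ)) * ∑ i, F k (z i).1 * (z i).2) := by
    rw [hrisk, hres, ← sub_add, ← Finset.sum_sub_distrib]
    congr 1
    refine Finset.sum_congr rfl fun k _ => ?_
    rw [← Finset.sum_sub_distrib]
    refine Finset.sum_congr rfl fun l _ => ?_
    rw [Finset.sum_sub_distrib]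
    simp only [Finset.sum_const, Finset.card_univ, Fintype.card_fin, nsmul_eq_mul]
    field_simp
  have hτ : 0 ≤ ∑ k, |coef k| := Finset.sum_nonneg fun _ _ => abs_nonneg _
  have b1 : (∑ k, ∑ l, coef k * coef l * ((1 / (n : ℝ)) * ∑ i, ((∫ x, F k x * F l x ∂μ) -
        F k (z i).1 * F l (z i).1))) ≤ (∑ k, |coef k|) ^ 2 * B₁ := by
    rw [sq, Finset.sum_mul_sum, Finset.sum_mul]
    refine Finset.sum_le_sum fun k _ => ?_
    rw [Finset.sum_mul]
    refine Finset.sum_le_sum fun l _ => ?_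
    refine (le_abs_self _).trans ?_
    rw [abs_mul, abs_mul (coef k)]
    exact mul_le_mul_of_nonneg_left (h₁ (k, l)) (by positivity)
  have b2 : ∑ k, coef k * ((1 / (n : ℝ)) * ∑ i, F k (z i).1 * (z i).2) ≤
      (∑ k, |coef k|) * B₂ := by
    rw [Finset.sum_mul]
    refine Finset.sum_le_sum fun k _ => ?_
    refine (le_abs_self _).trans ?_
    rw [abs_mul]
    exact mul_le_mul_of_nonneg_left (h₂ k) (abs_nonneg _)
  have b3 : (∑ k, |coef k|) ^ 2 * B₁ ≤ τ ^ 2 * B₁ := by gcongr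
  have b4 : (∑ k, |coef k|) * B₂ ≤ τ * B₂ := by gcongr
  rw [hdiff]
  linarith

/-- The logarithmic factor of the slow rate. -/
noncomputable def slowLog (n M : ℕ) : ℝ := Real.log (1 + max (M : ℝ) (n : ℝ) / Real.sqrt n)

theorem slowLog_pos (hn : 1 ≤ n) : 0 < slowLog n M := by
  have h1 : (0 : ℝ) < n := by positivity
  have h2 : 0 < max (M : ℝ) n / Real.sqrt n := div_pos (lt_max_of_lt_right h1) (Real.sqrt_pos.2 h1)
  exact Real.log_pos (by linarith)

/-- With N = M ∨ n ≥ n, (1 + N/√n)² ≥ 1 + N²/n ≥ 1 + N. -/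
theorem log_one_add_max_le (hn : 1 ≤ n) :
    Real.log (1 + max (M : ℝ) (n : ℝ)) ≤ 2 * slowLog n M := by
  have h1 : (0 : ℝ) < n := by positivity
  set N := max (M : ℝ) (n : ℝ)
  have hN : (n : ℝ) ≤ N := le_max_right _ _
  have h2 : (N / Real.sqrt n) ^ 2 = N * (N / n) := by
    rw [div_pow, Real.sq_sqrt h1.le]; ring
  have h3 : 1 ≤ N / n := (one_le_div h1).2 hN
  have h4 : N ≤ N * (N / n) := le_mul_of_one_le_right (h1.le.trans hN) h3
  have h5 : 0 ≤ N / Real.sqrt n := div_nonneg (h1.le.trans hN) (Real.sqrt_nonneg _)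
  have h6 : 2 * slowLog n M = Real.log ((1 + N / Real.sqrt n) ^ 2) := by
    rw [Real.log_pow]; rfl
  rw [h6]
  exact Real.log_le_log (by linarith) (by nlinarith)

/-- The constant of the slow rate. -/
noncomputable def slowConst (L T v : ℝ) : ℝ :=
  (T + 1) ^ 2 * (L ^ 4 / 2 + 6) + 2 * (T + 1) * (v * L ^ 2 / 2 + 6)

/-- Uniform control of the risk over the `ℓ₁`-ball at the slow rate. -/
theorem exists_dominating_slow (hL : 0 ≤ L) (hT : 1 ≤ T) (hfm : Measurable f)
    (hfsm : ∀ j, Measurable (fs j)) (hf : ∀ x, |f x| ≤ L) (hfs : ∀ j x, |fs j x| ≤ L)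
    (hn : 1 ≤ n) (hM : 1 ≤ M)
    (hZ : ∀ i, HasLaw (Z i) (μ.prod (gaussianReal 0 v)) P)
    (hindep : iIndepFun Z P) :
    ∃ R : Ω → ℝ, Integrable R P ∧
      ∫ ω, R ω ∂P ≤ slowConst L T v * Real.sqrt (slowLog n M / n) ∧
      ∀ ω, ∀ lam ∈ l1Ball M T,
        risk μ f fs lam - 1 * centeredResidual f fs (fun i => Z i ω) lam ≤ R ω := by
  have hn0 : (0 : ℝ) < n := by positivity
  have hl := slowLog_pos (M := M) hn
  set l := slowLog n M
  set s := Real.sqrt (l / n) with hs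
  have hspos : 0 < s := Real.sqrt_pos.2 (by positivity)
  have hssq : s ^ 2 = l / n := Real.sq_sqrt (by positivity)
  lift L to ℝ≥0 using hL
  -- The target f joins the dictionary with coefficient -1, so f_λ - f is a combination with ℓ₁-norm
  -- at most T + 1.
  let F : Option (Fin M) → S → ℝ := fun o => o.elim f fs
  have hFm : ∀ o, Measurable (F o) := by rintro (_ | j); exacts [hfm, hfsm j]
  have hF : ∀ o x, |F o x| ≤ L := by rintro (_ | j) x; exacts [hf x, hfs j x]
  have hFF : ∀ (p : Option (Fin M) × Option (Fin M)) x, |F p.1 x * F p.2 x| ≤ (L * L : ℝ≥0) := by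
    intro p x
    rw [abs_mul]
    push_cast
    exact mul_le_mul (hF _ x) (hF _ x) (abs_nonneg _) L.coe_nonneg
  obtain ⟨B₁, hB₁, hB₁int, hB₁dom⟩ := exists_dominating_abs_average hn hZ hindep
    (ψ := fun (p : Option (Fin M) × Option (Fin M)) (z : S × ℝ) =>
      (∫ x, F p.1 x * F p.2 x ∂μ) - F p.1 z.1 * F p.2 z.1)
    (fun p => by have := hFm p.1; have := hFm p.2; fun_prop)
    (fun p => hasSubgaussianMGF_mean_sub (g := fun x => F p.1 x * F p.2 x)
      ((hFm p.1).mul (hFm p.2)) (hFF p) _) hspos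
  obtain ⟨B₂, hB₂, hB₂int, hB₂dom⟩ := exists_dominating_abs_average hn hZ hindep
    (ψ := fun (o : Option (Fin M)) (z : S × ℝ) => F o z.1 * z.2)
    (fun o => by have := hFm o; fun_prop)
    (fun o => hasSubgaussianMGF_noise_mul (hFm o) (hF o)) hspos
  refine ⟨fun ω => (T + 1) ^ 2 * B₁ ω + 2 * (T + 1) * B₂ ω,
    (hB₁.const_mul _).add (hB₂.const_mul _), ?_, ?_⟩
  · rw [integral_add (hB₁.const_mul _) (hB₂.const_mul _), integral_const_mul, integral_const_mul]
    have hM1 : (1 : ℝ) ≤ M := by exact_mod_cast hM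
    have hlog : 3 * Real.log (1 + M) ≤ 6 * l := by
      have h1 : Real.log (1 + (M : ℝ)) ≤ Real.log (1 + max (M : ℝ) n) :=
        Real.log_le_log (by positivity) (by gcongr; exact le_max_left _ _)
      have h2 := log_one_add_max_le (M := M) hn
      linarith
    -- Both family sizes, 2(M+1)² and 2(M+1), are at most (1+M)³. With s² = l/n, the logarithmic
    -- term of the maximal inequality is then of order s, like its variance term.
    have hlog3 : ∀ y : ℝ, 0 < y → y ≤ (1 + M) ^ 3 → Real.log y / (s * n) ≤ 6 * s := by
      intro y hy hy3
      have h1 : Real.log y ≤ 6 * l := by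
        refine (Real.log_le_log hy hy3).trans ?_
        rw [Real.log_pow]
        exact_mod_cast hlog
      rw [div_le_iff₀ (by positivity)]
      have h2 : 6 * s * (s * n) = 6 * l := by
        calc 6 * s * (s * n) = 6 * (s ^ 2 * n) := by ring
          _ = 6 * l := by rw [hssq]; field_simp
      rwa [h2]
    have h1 := hlog3 (2 * Fintype.card (Option (Fin M) × Option (Fin M)))
      (by simp; positivity) (by simp; nlinarith [sq_nonneg ((M : ℝ) + 1)])
    have h2 := hlog3 (2 * Fintype.card (Option (Fin M)))
      (by simp; positivity) (by simp; nlinarith [sq_nonneg ((M : ℝ) + 1)])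
    have h3 : ∫ ω, B₁ ω ∂P ≤ (L ^ 4 / 2 + 6) * s := by
      refine hB₁int.trans ?_
      push_cast at h1 ⊢
      nlinarith
    have h4 : ∫ ω, B₂ ω ∂P ≤ (v * L ^ 2 / 2 + 6) * s := by
      refine hB₂int.trans ?_
      push_cast at h2 ⊢
      nlinarith
    have h5 := mul_le_mul_of_nonneg_left h3 (show (0 : ℝ) ≤ (T + 1) ^ 2 by positivity)
    have h6 := mul_le_mul_of_nonneg_left h4 (show (0 : ℝ) ≤ 2 * (T + 1) by linarith)
    unfold slowConst
    linarith
  · intro ω lam hlam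
    rw [one_mul]
    refine risk_sub_centeredResidual_le (κ := Option (Fin M)) (F := F) (L := L)
      (coef := fun o => o.elim (-1) lam) hn hFm hF ?_ ?_ _ (hB₁dom ω) (hB₂dom ω)
      ((abs_nonneg _).trans (hB₁dom ω (none, none))) ((abs_nonneg _).trans (hB₂dom ω none))
    · intro x
      rw [Fintype.sum_option]
      simp [F, comb]
      ring
    · rw [Fintype.sum_option]
      have := mem_l1Ball.1 hlam
      simp
      linarith

end SlowRate

/-! ### Penalty bounds and the oracle inequalities in both regimes. -/

theorem hardPenalty_le {n M : ℕ} {K₁ : ℝ} (hK : 0 ≤ K₁) {lam : Fin M → ℝ} {m : ℕ}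
    (hm : numNonzero lam ≤ m) :
    hardPenalty n K₁ lam ≤ K₁ * (m / n * Real.log (1 + max (M : ℝ) n)) := by
  unfold hardPenalty
  rw [mul_assoc]
  have h1 : (0 : ℝ) ≤ max (M : ℝ) n := le_max_of_le_left (by positivity)
  have h2 : max (M : ℝ) n / max (numNonzero lam : ℝ) 1 ≤ max (M : ℝ) n :=
    div_le_self h1 (le_max_right _ _)
  have h3 : 0 ≤ max (M : ℝ) n / max (numNonzero lam : ℝ) 1 := by positivity
  have h4 : (numNonzero lam : ℝ) ≤ m := by exact_mod_cast hm
  refine mul_le_mul_of_nonneg_left (mul_le_mul (by gcongr)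
    (Real.log_le_log (by linarith) (by linarith)) (Real.log_nonneg (by linarith))
    (by positivity)) hK

section OracleInequalities

variable {S : Type*} [MeasurableSpace S] {μ : Measure S} [IsProbabilityMeasure μ] {n M : ℕ}
  {f : S → ℝ} {fs : Fin M → S → ℝ} {L T : ℝ} {v : ℝ≥0} {Ω : Type*} [MeasurableSpace Ω]
  {P : Measure Ω} [IsProbabilityMeasure P] {Z : Fin n → Ω → S × ℝ}

/-- The oracle inequality at the parametric rate, for few functions. -/
theorem integral_risk_estimator_le_fast (hL : 0 ≤ L) (hT : 1 ≤ T) (hfm : Measurable f)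
    (hfsm : ∀ j, Measurable (fs j)) (hf : ∀ x, |f x| ≤ L) (hfs : ∀ j x, |fs j x| ≤ L)
    (hM : 2 ≤ M) (hMn : (M : ℝ) ≤ Real.sqrt n)
    (hZ : ∀ i, HasLaw (Z i) (μ.prod (gaussianReal 0 v)) P)
    (hindep : iIndepFun Z P) (hv : 0 < v) {ε : ℝ} (hε : 0 < ε) {K₁ : ℝ} (hK : 0 ≤ K₁)
    {lamHat : Ω → Fin M → ℝ} (hm : AEMeasurable lamHat P)
    (hlse : ∀ᵐ ω ∂P, IsPenalizedLSE T K₁ fs (fun i => (Z i ω).1)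
      (fun i => f (Z i ω).1 + (Z i ω).2) (lamHat ω))
    {lam : Fin M → ℝ} (hlam : lam ∈ simplex M) :
    ∫ ω, risk μ f fs (lamHat ω) ∂P ≤ (1 + ε) * risk μ f fs lam +
      (2 * (1 + ε) * K₁ + fastConst L T v * (1 + ε + ε⁻¹)) * (M * Real.log n / n) := by
  have hM2 : (M : ℝ) ^ 2 ≤ n := (Real.le_sqrt' (by positivity)).1 hMn
  have hM2' : M ^ 2 ≤ n := by exact_mod_cast hM2
  have hn4 : 4 ≤ n := by nlinarith
  have hMn' : M ≤ n := by nlinarith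
  have hn0 : (0 : ℝ) < n := by positivity
  have hn2 : (2 : ℝ) ≤ n := by exact_mod_cast (by omega : 2 ≤ n)
  obtain ⟨R, hR, hRint, hdom⟩ := exists_dominating_fast (μ := μ) hL hT hfm hfsm hf hfs
    (by omega) (by omega) hMn' hZ hindep hv hε
  have h1 := integral_risk_estimator_le hL hfm hfsm hf hfs (by omega) hZ hK
    (by positivity : (0 : ℝ) ≤ 1 + ε) hR hdom hm hlse (simplex_subset_l1Ball hT hlam)
  have h2 : hardPenalty n K₁ lam ≤ K₁ * (2 * (M * Real.log n / n)) := by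
    refine (hardPenalty_le (m := M) hK ?_).trans (mul_le_mul_of_nonneg_left ?_ hK)
    · exact (Finset.card_filter_le _ _).trans (by simp)
    · have h3 : Real.log (1 + max (M : ℝ) n) ≤ 2 * Real.log n := by
        rw [max_eq_right (by exact_mod_cast hMn')]
        have : 2 * Real.log n = Real.log ((n : ℝ) ^ 2) := by rw [Real.log_pow]; norm_num
        rw [this]
        exact Real.log_le_log (by positivity) (by nlinarith)
      calc (M : ℝ) / n * Real.log (1 + max (M : ℝ) n) ≤ M / n * (2 * Real.log n) := by gcongr
        _ = _ := by ring
  have h3 := mul_le_mul_of_nonneg_left h2 (by positivity : (0 : ℝ) ≤ 1 + ε)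
  linarith

/-- The oracle inequality at the slow rate. -/
theorem integral_risk_estimator_le_slow (hL : 0 ≤ L) (hT : 1 ≤ T) (hfm : Measurable f)
    (hfsm : ∀ j, Measurable (fs j)) (hf : ∀ x, |f x| ≤ L) (hfs : ∀ j x, |fs j x| ≤ L)
    (hn : 1 ≤ n) (hM : 1 ≤ M)
    (hZ : ∀ i, HasLaw (Z i) (μ.prod (gaussianReal 0 v)) P)
    (hindep : iIndepFun Z P) {K₁ : ℝ} (hK : 0 ≤ K₁)
    {lamHat : Ω → Fin M → ℝ} (hm : AEMeasurable lamHat P)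
    (hlse : ∀ᵐ ω ∂P, IsPenalizedLSE T K₁ fs (fun i => (Z i ω).1)
      (fun i => f (Z i ω).1 + (Z i ω).2) (lamHat ω))
    {lam : Fin M → ℝ} (hlam : lam ∈ simplex M) :
    ∫ ω, risk μ f fs (lamHat ω) ∂P ≤ risk μ f fs lam +
      (4 * K₁ + slowConst L T v + L ^ 2 + ((T + 1) * L) ^ 2) * Real.sqrt (slowLog n M / n) := by
  have hn0 : (0 : ℝ) < n := by positivity
  have hl := slowLog_pos (M := M) hn
  have hlog := log_one_add_max_le (M := M) hn
  set l := slowLog n M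
  set s := Real.sqrt (l / n) with hs
  have hspos : 0 < s := Real.sqrt_pos.2 (by positivity)
  have hssq : s ^ 2 = l / n := Real.sq_sqrt (by positivity)
  have hC : 0 ≤ slowConst L T v := by
    unfold slowConst
    have : 0 ≤ T + 1 := by linarith
    positivity
  have hr := risk_nonneg (μ := μ) (f := f) (fs := fs) lam
  -- If s > 1, the trivial bound ((T+1)L)² on the risk is already below the rate. Otherwise ⌈1/s⌉ ≤
  -- 2/s.
  rcases le_or_gt s 1 with hs1 | hs1
  · obtain ⟨R, hR, hRint, hdom⟩ := exists_dominating_slow (μ := μ) hL hT hfm hfsm hf hfs hn hM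
      hZ hindep
    -- This sparsity balances the Maurey error L²/m against the penalty, of order K₁ m l/n = K₁ m
    -- s²; both become of order s.
    set m := ⌈1 / s⌉₊ with hmdef
    have hm1 : 1 ≤ m := Nat.one_le_ceil_iff.2 (by positivity)
    have hmge : 1 / s ≤ m := Nat.le_ceil _
    have hmle : (m : ℝ) ≤ 2 / s := by
      have h1 := (Nat.ceil_lt_add_one (by positivity : 0 ≤ 1 / s)).le
      have h2 : 1 ≤ 1 / s := (one_le_div hspos).2 hs1
      have h3 : 2 / s = 1 / s + 1 / s := by ring
      linarith
    obtain ⟨theta, hth, hnum, hrisk⟩ := exists_sparse_risk_le (μ := μ) hfm hfsm hf hfs hlam hm1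
    have h1 := integral_risk_estimator_le hL hfm hfsm hf hfs hn hZ hK zero_le_one hR hdom hm hlse
      (simplex_subset_l1Ball hT hth)
    have h2 : hardPenalty n K₁ theta ≤ K₁ * (4 * s) := by
      refine (hardPenalty_le hK hnum).trans (mul_le_mul_of_nonneg_left ?_ hK)
      calc (m : ℝ) / n * Real.log (1 + max (M : ℝ) n) ≤ (2 / s) / n * (2 * l) := by
            have : 0 ≤ Real.log (1 + max (M : ℝ) n) := Real.log_nonneg (by
              have : (0 : ℝ) ≤ max (M : ℝ) n := le_max_of_le_left (by positivity)
              linarith)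
            gcongr
        _ = 4 / s * (l / n) := by ring
        _ = 4 * s := by rw [← hssq]; field_simp
    have h3 : L ^ 2 / m ≤ L ^ 2 * s := by
      rw [div_eq_mul_one_div]
      refine mul_le_mul_of_nonneg_left ?_ (sq_nonneg L)
      rw [div_le_iff₀ (by positivity)]
      have h4 := mul_le_mul_of_nonneg_left hmge hspos.le
      rwa [mul_one_div_cancel hspos.ne'] at h4
    have h4 : 0 ≤ ((T + 1) * L) ^ 2 * s := by positivity
    linarith
  · have h1 : ∫ ω, risk μ f fs (lamHat ω) ∂P ≤ ((T + 1) * L) ^ 2 := by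
      have h2 := integral_mono_ae (integrable_risk_estimator (μ := μ) hL hfm hfsm hf hfs hm
        (hlse.mono fun ω h => h.1)) (integrable_const (((T + 1) * L) ^ 2))
        (hlse.mono fun ω h => risk_le (μ := μ) hL hfm hfsm hf hfs h.1)
      simpa using h2
    have h2 : ((T + 1) * L) ^ 2 * 1 ≤ ((T + 1) * L) ^ 2 * s := by gcongr
    have h3 : 0 ≤ (4 * K₁ + slowConst L T v + L ^ 2) * s := by positivity
    linarith

/-- Both regimes together, for an arbitrary non-negative tuning constant of the penalty. -/
theorem integral_risk_estimator_le_convexRate (hL : 0 ≤ L) (hT : 1 ≤ T) (hfm : Measurable f)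
    (hfsm : ∀ j, Measurable (fs j)) (hf : ∀ x, |f x| ≤ L) (hfs : ∀ j x, |fs j x| ≤ L)
    (hn : 1 ≤ n) (hM : 2 ≤ M)
    (hZ : ∀ i, HasLaw (Z i) (μ.prod (gaussianReal 0 v)) P)
    (hindep : iIndepFun Z P) (hv : 0 < v) {ε : ℝ} (hε : 0 < ε) {K₁ : ℝ} (hK : 0 ≤ K₁)
    {lamHat : Ω → Fin M → ℝ} (hm : AEMeasurable lamHat P)
    (hlse : ∀ᵐ ω ∂P, IsPenalizedLSE T K₁ fs (fun i => (Z i ω).1)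
      (fun i => f (Z i ω).1 + (Z i ω).2) (lamHat ω))
    {lam : Fin M → ℝ} (hlam : lam ∈ simplex M) :
    ∫ ω, risk μ f fs (lamHat ω) ∂P ≤ (1 + ε) * risk μ f fs lam +
      (4 * (1 + ε) * K₁ + (fastConst L T v + slowConst L T v + L ^ 2 + ((T + 1) * L) ^ 2) *
        (1 + ε + ε⁻¹)) * convexRate n M := by
  have hE : 1 ≤ 1 + ε + ε⁻¹ := by
    have : 0 < ε⁻¹ := by positivity
    linarith
  have hT1 : 0 ≤ T + 1 := by linarith
  have hT2 : 0 ≤ T + 2 := by linarith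
  have hlogT : 0 ≤ Real.log (4 * T) := Real.log_nonneg (by linarith)
  have hF : 0 ≤ fastConst L T v := by unfold fastConst; positivity
  have hS : 0 ≤ slowConst L T v := by unfold slowConst; positivity
  have hr := risk_nonneg (μ := μ) (f := f) (fs := fs) lam
  have hQ : 0 ≤ slowConst L T v + L ^ 2 + ((T + 1) * L) ^ 2 := by positivity
  unfold convexRate
  split_ifs with hMn
  · refine (integral_risk_estimator_le_fast hL hT hfm hfsm hf hfs hM hMn hZ hindep hv hε hK hm hlse
      hlam).trans ?_
    have hlogn : 0 ≤ Real.log n := Real.log_natCast_nonneg n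
    have h1 : 2 * (1 + ε) * K₁ + fastConst L T v * (1 + ε + ε⁻¹) ≤ 4 * (1 + ε) * K₁ +
        (fastConst L T v + slowConst L T v + L ^ 2 + ((T + 1) * L) ^ 2) * (1 + ε + ε⁻¹) := by
      have h2 : 0 ≤ (1 + ε) * K₁ := by positivity
      have h3 := mul_nonneg hQ (zero_le_one.trans hE)
      linarith
    have h2 := mul_le_mul_of_nonneg_right h1 (by positivity : 0 ≤ M * Real.log n / n)
    linarith
  · refine (integral_risk_estimator_le_slow hL hT hfm hfsm hf hfs hn (by omega) hZ hindep hK hm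
      hlse hlam).trans ?_
    have h1 : 4 * K₁ + slowConst L T v + L ^ 2 + ((T + 1) * L) ^ 2 ≤ 4 * (1 + ε) * K₁ +
        (fastConst L T v + slowConst L T v + L ^ 2 + ((T + 1) * L) ^ 2) * (1 + ε + ε⁻¹) := by
      have h2 : 0 ≤ ε * K₁ := by positivity
      have h3 := mul_le_mul_of_nonneg_left hE hQ
      have h4 := mul_nonneg hF (zero_le_one.trans hE)
      linarith
    have h2 := mul_le_mul_of_nonneg_right h1 (Real.sqrt_nonneg (slowLog n M / n))
    have h3 : 0 ≤ ε * risk μ f fs lam := by positivity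
    unfold slowLog at h2 ⊢
    linarith

end OracleInequalities

theorem convexRate_nonneg (n M : ℕ) : 0 ≤ convexRate n M := by
  unfold convexRate
  have := Real.log_natCast_nonneg n
  split_ifs <;> positivity

instance nonempty_simplex (M : ℕ) : Nonempty (simplex M) :=
  ⟨⟨0, fun _ => le_rfl, by simp⟩⟩

end Aggregation

theorem corollary3p8 (L : ℝ) (hL : 0 ≤ L) (σ : ℝ≥0) (hσ : 0 < σ) (T : ℝ) (hT : 1 ≤ T) :
    ∃ Kstar : ℝ → ℝ, (∀ ε : ℝ, 0 < ε → 0 < Kstar ε) ∧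
      ∀ κ : ℝ, 1 ≤ κ → ∃ C' : ℝ, 0 < C' ∧
        ∀ ε : ℝ, 0 < ε → ∀ K₁ : ℝ, Kstar ε ≤ K₁ → K₁ ≤ κ * Kstar ε →
        ∀ n M : ℕ, 1 ≤ n → 2 ≤ M →
        -- the design space, the design distribution and the functions
        ∀ (d : ℕ) (S : Set (EuclideanSpace ℝ (Fin d))), MeasurableSet S →
        ∀ (μ : Measure S) [IsProbabilityMeasure μ] (f : S → ℝ) (fs : Fin M → S → ℝ),
          Measurable f → (∀ j, Measurable (fs j)) →
          (∀ x, |f x| ≤ L) → (∀ j x, |fs j x| ≤ L) →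
        -- the regression model `Y_i = f(X_i) + W_i`
        ∀ (Ω : Type*) [MeasurableSpace Ω] (P : Measure Ω) [IsProbabilityMeasure P]
          (X : Fin n → Ω → S) (W Y : Fin n → Ω → ℝ),
          (∀ i, HasLaw (X i) μ P) →
          (∀ i, HasLaw (W i) (gaussianReal 0 (σ ^ 2)) P) →
          (∀ i, IndepFun (X i) (W i) P) →
          iIndepFun (fun i ω => (X i ω, W i ω)) P →
          (∀ i ω, Y i ω = f (X i ω) + W i ω) →
        -- the penalized least squares estimator
        ∀ lamHat : Ω → Fin M → ℝ, AEMeasurable lamHat P →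
          (∀ᵐ ω ∂P, IsPenalizedLSE T K₁ fs (fun i => X i ω) (fun i => Y i ω) (lamHat ω)) →
          Integrable (fun ω => l2Norm μ (fun x => comb fs (lamHat ω) x - f x) ^ 2) P ∧
          ∫ ω, l2Norm μ (fun x => comb fs (lamHat ω) x - f x) ^ 2 ∂P ≤
            (1 + ε) * (⨅ lam : simplex M, l2Norm μ (fun x => comb fs lam x - f x) ^ 2) +
              C' * (1 + ε + ε⁻¹) * convexRate n M := by
  have hT1 : 0 ≤ T + 1 := by linarith
  have hT2 : 0 ≤ T + 2 := by linarith
  have hlogT : 0 ≤ Real.log (4 * T) := Real.log_nonneg (by linarith)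
  have hF : 0 ≤ fastConst L T (σ ^ 2 : ℝ≥0) := by unfold fastConst; positivity
  have hS : 0 ≤ slowConst L T (σ ^ 2 : ℝ≥0) := by unfold slowConst; positivity
  -- Since (1+ε)(1+ε⁻¹) = 2 + ε + ε⁻¹ ≤ 2(1+ε+ε⁻¹), the term 4(1+ε)K₁ contributes 8κ to the
  -- constant.
  refine ⟨fun ε => 1 + ε⁻¹, fun ε hε => by positivity, fun κ hκ =>
    ⟨8 * κ + (fastConst L T (σ ^ 2 : ℝ≥0) + slowConst L T (σ ^ 2 : ℝ≥0) + L ^ 2 +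
      ((T + 1) * L) ^ 2), by positivity, ?_⟩⟩
  intro ε hε K₁ hK hKκ n M hn hM d S _ μ _ f fs hfm hfsm hf hfs Ω _ P _ X W Y hX hW hXW hindep hY
    lamHat hm hlse
  have hZ : ∀ i, HasLaw (fun ω => (X i ω, W i ω)) (μ.prod (gaussianReal 0 (σ ^ 2))) P :=
    fun i => hasLaw_prodMk (hX i) (hW i) (hXW i)
  have hK0 : 0 ≤ K₁ := le_trans (by positivity) hK
  simp only [hY] at hlse
  simp only [l2Norm_sq]
  refine ⟨integrable_risk_estimator (μ := μ) hL hfm hfsm hf hfs hm (hlse.mono fun ω h => h.1), ?_⟩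
  have hmain := fun lam : simplex M => integral_risk_estimator_le_convexRate (μ := μ) hL hT hfm hfsm
    hf hfs hn hM hZ hindep (by positivity) hε hK0 hm hlse lam.2
  have hconst : 4 * (1 + ε) * K₁ ≤ 8 * κ * (1 + ε + ε⁻¹) := by
    have h1 : (1 + ε) * (1 + ε⁻¹) = 2 + ε + ε⁻¹ := by field_simp; ring
    calc 4 * (1 + ε) * K₁ ≤ 4 * (1 + ε) * (κ * (1 + ε⁻¹)) := by gcongr
      _ = 4 * κ * (2 + ε + ε⁻¹) := by rw [← h1]; ring
      _ ≤ 4 * κ * (2 * (1 + ε + ε⁻¹)) := by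
        have : 0 < ε⁻¹ := by positivity
        gcongr
        linarith
      _ = _ := by ring
  have hrate := mul_le_mul_of_nonneg_right hconst (convexRate_nonneg n M)
  -- The bound, solved for the risk of λ, holds for every λ in the nonempty simplex, so it passes to
  -- the infimum without requiring a minimizer.
  have hinf : ((∫ ω, risk μ f fs (lamHat ω) ∂P) -
      (8 * κ + (fastConst L T (σ ^ 2 : ℝ≥0) + slowConst L T (σ ^ 2 : ℝ≥0) + L ^ 2 +
      ((T + 1) * L) ^ 2)) * (1 + ε + ε⁻¹) * convexRate n M) / (1 + ε) ≤
      ⨅ lam : simplex M, risk μ f fs lam := by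
    refine le_ciInf fun lam => ?_
    rw [div_le_iff₀ (by positivity)]
    have := hmain lam
    linarith
  rw [div_le_iff₀ (by positivity)] at hinf
  linarith
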